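/- Let $p$ be an odd prime, $L/K$ a separable field extension of degree $p^3$, $\tilde L$ its normal closure and $G=\mathrm{Gal}(\tilde L/K)$. A Hopf Galois structure on $L/K$ is a pair $(H,\mu)$, where $H$ is a finite-dimensional cocommutative $K$-Hopf algebra and $\mu:H\to\mathrm{End}_K(L)$ makes $L$ a left $H$-module algebra such that the induced $K$-linear map $L\otimes_K H\to\mathrm{End}_K(L)$, $x\otimes h\mapsto (y\mapsto x\,\mu(h)(y))$, is bijective. It has type $N$, for a group $N$, if $\tilde L\otimes_K H\cong\tilde L[N]$ as $\tilde L$-Hopf algebras. Structures are counted up to isomorphism of Hopf algebras compatible with the actions. Write $C_n$ for the cyclic group of order $n$. Then $L/K$ has a Hopf Galois structure of type $C_{p^3}$ if and only if $G$ is isomorphic to a semidirect product $C_{p^3}\rtimes C_D$, with $C_D$ acting faithfully on $C_{p^3}$, for some $D=p^a d$ with $0\le a\le 2$ and $d\mid p-1$. Moreover, whenever $G\cong C_{p^3}\rtimes C_D$ (for any action of $C_D$ on $C_{p^3}$) with $D=p^a d$, $0\le a\le 2$, $d\mid p-1$, the number of Hopf Galois structures of type $C_{p^3}$ on $L/K$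 is $1$ if $d>1$, $p^2$ if $D=1$, and $p^{3-a}$ if $D=p^a$ with $a=1$ or $2$. -/

import Mathlib

open scoped TensorProduct

universe u v w

/-- A Hopf Galois structure on the extension `L / K`: a finite cocommutative `K`-Hopf algebra `H`
together with a Hopf action `μ : H → End_K(L)`, that is, `μ` makes `L` a left `H`-module algebra
and the induced `K`-linear map `L ⊗ H → End_K(L)` is bijective.
A finite `K`-algebra is in bijection with some `K ^ n`, so the universe of `K` is large enough
for `H`. -/
structure HopfGaloisStructure (K : Type u) (L : Type v) [Field K] [Field L] [Algebra K L] where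
  /-- the Hopf algebra -/
  H : Type u
  [ring : Ring H]
  [hopfAlgebra : HopfAlgebra K H]
  [finite : Module.Finite K H]
  [cocomm : Coalgebra.IsCocomm K H]
  /-- the action; being an algebra map, it makes `L` a left `H`-module -/
  μ : H →ₐ[K] Module.End K L
  /-- `h (x y) = ∑ h₁(x) h₂(y)`, where `Δ h = ∑ h₁ ⊗ h₂` -/
  map_mul : ∀ (h : H) (x y : L), μ h (x * y) =
    LinearMap.mul' K L (TensorProduct.map (μ.toLinearMap.flip x) (μ.toLinearMap.flip y)
      (Coalgebra.comul (R := K) h))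
  /-- `h 1 = ε(h) 1` -/
  map_one : ∀ h : H, μ h 1 = algebraMap K L (Coalgebra.counit (R := K) h)
  /-- `x ⊗ h ↦ (y ↦ x h(y))` is a bijection from `L ⊗ H` to `End_K(L)` -/
  bijective : Function.Bijective
    (TensorProduct.lift ((LinearMap.mul K (Module.End K L)).compl₁₂
      (Algebra.lmul K L).toLinearMap μ.toLinearMap) : L ⊗[K] H →ₗ[K] Module.End K L)

namespace HopfGaloisStructure

attribute [instance] ring hopfAlgebra finite cocomm

variable {K : Type u} {L : Type v} [Field K] [Field L] [Algebra K L]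

/-- Two Hopf Galois structures are isomorphic if there is an isomorphism of the Hopf algebras that
is compatible with the actions. (A bialgebra isomorphism preserves the antipodes.) -/
def Iso (S T : HopfGaloisStructure K L) : Prop :=
  ∃ e : S.H ≃ₐc[K] T.H, ∀ h : S.H, T.μ (e h) = S.μ h

theorem iso_equivalence : Equivalence (Iso : HopfGaloisStructure K L → _ → Prop) where
  refl _ := ⟨BialgEquiv.refl K _, fun _ => rfl⟩
  symm := by
    rintro S T ⟨e, he⟩
    refine ⟨e.symm, fun h => ?_⟩
    rw [← he, BialgEquiv.apply_symm_apply]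
  trans := by
    rintro S T U ⟨e, he⟩ ⟨f, hf⟩
    exact ⟨e.trans f, fun h => (hf (e h)).trans (he h)⟩

instance setoid (K : Type u) (L : Type v) [Field K] [Field L] [Algebra K L] :
    Setoid (HopfGaloisStructure K L) :=
  ⟨Iso, iso_equivalence⟩

/-- For a normal closure `E` of the separable extension `L / K`, the structure has type `N` if
`E ⊗ H` is isomorphic, as a Hopf algebra over `E`, to the group algebra `E[N]`; equivalently, `H`
is the fixed algebra `E[N]^G` for some action by automorphisms of `G = Gal(E / K)` on `N`. -/
def HasType (E : Type w) [Field E] [Algebra K E] (S : HopfGaloisStructure K L)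
    (N : Type*) [Group N] : Prop :=
  Nonempty ((E ⊗[K] S.H) ≃ₐc[E] MonoidAlgebra E N)

/-- The number of isomorphism classes of Hopf Galois structures of type `N` on `L / K`,
where `E` is a normal closure of `L / K`. -/
noncomputable def numberOfType (K : Type u) (L : Type v) [Field K] [Field L] [Algebra K L]
    (E : Type w) [Field E] [Algebra K E] (N : Type*) [Group N] : ℕ :=
  Set.ncard {c : Quotient (setoid K L) | ∃ S : HopfGaloisStructure K L,
    Quotient.mk (setoid K L) S = c ∧ S.HasType E N}

end HopfGaloisStructure

/-- The cyclic group of order `n` (for `n ≠ 0`), written multiplicatively. -/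
abbrev CyclicGrp (n : ℕ) : Type := Multiplicative (ZMod n)

/-! Write `E` for the normal closure, `G` for its Galois group and `X` for the set of embeddings `L
→ E`; `G` acts on `X` faithfully and transitively. By Greither and Pareigis, structures of type `N`
correspond to the regular subgroups of `Perm X` that are isomorphic to `N` and normalized by `G`
(`exists_hasType_iff`, `numberOfType_eq_ncard`). In one direction, `E ⊗ H` acts on `Hom_K(L, E)` by
composition and its group-like elements permute `X`; in the other, Galois descent makes `E[N]^G` a
Hopf algebra acting on `L`. What remains is a question about permutation groups of degree `p ^ 3`.

A regular cyclic group `R` identifies `X` with `ZMod (p ^ 3)` so that `R` becomes the translations,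
and its normalizer becomes the affine group. Suppose `G` normalizes `R`. Then `G` has a normal
cyclic subgroup of order `p ^ 3` (`exists_normal_isCyclic_of_stableRegular`). By transitivity and
faithfulness this subgroup is regular, and a point stabilizer is a complement that embeds in the
cyclic group of units modulo `p ^ 3`; so `G` is the required semidirect product. Conversely, the
image of such a normal subgroup is itself a regular group normalized by `G`.

For the count, let `t` generate the normal regular cyclic subgroup of `G` and let `c` be its chart.
In a suitable chart for `R`, `t` becomes `i ↦ u i + 1`, and `R` is determined by `u`
(`ncard_stableRegular`). This map must be a `p ^ 3`-cycle, which means `u ^ p ^ 2 = 1`; and the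
stabilizer elements, `i ↦ v i` in the chart `c`, normalize `R` exactly when `u ^ v = u`, that is,
when `v ≡ 1` modulo the order of `u`. If `d > 1`, some `v - 1` is a unit and only `u = 1` survives.
If the stabilizer has order `1` or `p`, every `v` is `1` modulo `p ^ 2` and all `p ^ 2` values of
`u` survive. If it has order `p ^ 2`, only the `p` solutions of `u ^ p = 1` do. -/

/-! ### Embeddings into the normal closure and the Galois action on them -/

section NormalClosure

variable (K : Type u) (L : Type v) (E : Type w) [Field K] [Field L] [Field E]
  [Algebra K L] [Algebra K E]

/-- The Galois group of `E / K` acts on the embeddings of `L` into `E` by composition. -/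
def embeddingPerm : (E ≃ₐ[K] E) →* Equiv.Perm (L →ₐ[K] E) where
  toFun σ :=
    { toFun := fun x => σ.toAlgHom.comp x
      invFun := fun x => σ.symm.toAlgHom.comp x
      left_inv := fun x => by ext; simp
      right_inv := fun x => by ext; simp }
  map_one' := rfl
  map_mul' _ _ := rfl

variable {K L E}

@[simp]
lemma embeddingPerm_apply (σ : E ≃ₐ[K] E) (x : L →ₐ[K] E) (l : L) :
    embeddingPerm K L E σ x l = σ (x l) := rfl

variable (K L E) in
lemma embeddingPerm_transitive [IsNormalClosure K L E] (x y : L →ₐ[K] E) :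
    ∃ σ : E ≃ₐ[K] E, embeddingPerm K L E σ x = y := by
  have : Normal K E := IsNormalClosure.normal (K := L)
  let e : x.fieldRange ≃ₐ[K] y.fieldRange :=
    (AlgEquiv.ofInjectiveField x).symm.trans (AlgEquiv.ofInjectiveField y)
  refine ⟨e.liftNormal E, ?_⟩
  ext l
  have := e.liftNormal_commutes E (AlgEquiv.ofInjectiveField x l)
  have h2 : e (AlgEquiv.ofInjectiveField x l) = AlgEquiv.ofInjectiveField y l :=
    congrArg (AlgEquiv.ofInjectiveField y) ((AlgEquiv.ofInjectiveField x).symm_apply_apply l)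
  rw [h2] at this
  exact this

variable [FiniteDimensional K L] [IsNormalClosure K L E]

lemma card_embeddings [Algebra.IsSeparable K L] :
    Nat.card (L →ₐ[K] E) = Module.finrank K L := by
  rw [Nat.card_eq_fintype_card]
  exact AlgHom.card_of_splits K L E (IsNormalClosure.splits (F := K) (K := L) (L := E))

variable (K L E) in
lemma iSup_fieldRange_eq_top : (⨆ x : L →ₐ[K] E, x.fieldRange) = ⊤ := by
  have := (Algebra.IsAlgebraic.isNormalClosure_iff (F := K) (K := L) (L := E)).1 inferInstance
  exact this.2

lemma isGalois_of_isNormalClosure (K : Type u) (L : Type v) (E : Type w) [Field K]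
    [Field L] [Field E] [Algebra K L] [Algebra K E] [FiniteDimensional K L]
    [IsNormalClosure K L E] [Algebra.IsSeparable K L] : IsGalois K E := by
  have : Normal K E := IsNormalClosure.normal (K := L)
  have h : ∀ x : L →ₐ[K] E, Algebra.IsSeparable K x.fieldRange := fun x =>
    AlgEquiv.Algebra.isSeparable (AlgEquiv.ofInjectiveField x)
  have h2 : Algebra.IsSeparable K (⨆ x : L →ₐ[K] E, x.fieldRange : IntermediateField K E) :=
    inferInstance
  rw [iSup_fieldRange_eq_top] at h2
  have : Algebra.IsSeparable K E := AlgEquiv.Algebra.isSeparable IntermediateField.topEquiv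
  exact ⟨⟩

lemma finiteDimensional_of_isNormalClosure (K : Type u) (L : Type v) (E : Type w) [Field K]
    [Field L] [Field E] [Algebra K L] [Algebra K E] [FiniteDimensional K L]
    [IsNormalClosure K L E] : FiniteDimensional K E := by
  have h : FiniteDimensional K (IntermediateField.normalClosure K L E) :=
    normalClosure.is_finiteDimensional K L E
  rw [normalClosure_def, iSup_fieldRange_eq_top] at h
  exact IntermediateField.topEquiv.toLinearEquiv.finiteDimensional

-- The images of the embeddings generate `E`, so an automorphism that fixes each of them pointwise
-- is trivial.
variable (K L E) in
lemma embeddingPerm_injective : Function.Injective (embeddingPerm K L E) := by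
  intro σ τ h
  have key : (⊤ : IntermediateField K E) ≤
      IntermediateField.fixedField (Subgroup.zpowers (τ⁻¹ * σ)) := by
    rw [← iSup_fieldRange_eq_top K L E]
    refine iSup_le fun x => ?_
    rintro _ ⟨l, rfl⟩
    have h1 : σ (x l) = τ (x l) := DFunLike.congr_fun (Equiv.congr_fun h x) l
    have h2 : τ⁻¹ * σ ∈ MulAction.stabilizer (E ≃ₐ[K] E) (x l) := by
      rw [MulAction.mem_stabilizer_iff, mul_smul, inv_smul_eq_iff]
      exact h1
    rintro ⟨g, hg⟩
    exact (Subgroup.zpowers_le.2 h2) hg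
  have : τ⁻¹ * σ = 1 := by
    ext a
    exact key (x := a) trivial ⟨_, Subgroup.mem_zpowers _⟩
  exact (inv_mul_eq_one.1 this).symm

end NormalClosure

section Embeddings

variable {K : Type u} {L : Type v} {E : Type w} [Field K] [Field L] [Field E]
  [Algebra K L] [Algebra K E]

lemma finrank_linearMap_field [FiniteDimensional K L] :
    Module.finrank E (L →ₗ[K] E) = Module.finrank K L := by
  rw [Module.finrank_linearMap_self]

variable [FiniteDimensional K L] [Algebra.IsSeparable K L] [IsNormalClosure K L E]

variable (K L E) in
/-- The embeddings of `L` into a normal closure `E` form a basis of the linear maps. -/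
noncomputable def embeddingBasis : Module.Basis (L →ₐ[K] E) E (L →ₗ[K] E) :=
  basisOfLinearIndependentOfCardEqFinrank' _ (linearIndependent_toLinearMap K L E) (by
    rw [← Nat.card_eq_fintype_card, card_embeddings, finrank_linearMap_field])

lemma embeddingBasis_apply (x : L →ₐ[K] E) : embeddingBasis K L E x = x.toLinearMap := by
  simp [embeddingBasis]

end Embeddings

/-! ### From a Hopf Galois structure to a regular group of permutations -/

namespace HopfGaloisStructure

open Coalgebra

variable {K : Type u} {L : Type v} {E : Type w} [Field K] [Field L] [Field E]
  [Algebra K L] [Algebra K E]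

/-- The map `c ⊗ h ↦ c • (φ ∘ h)`: the action of `E ⊗ H` on linear maps `L → E`, from the right. -/
noncomputable def twist (S : HopfGaloisStructure K L) (φ : L →ₗ[K] E) :
    E ⊗[K] S.H →ₗ[E] (L →ₗ[K] E) :=
  LinearMap.liftBaseChange E (LinearMap.llcomp K L L E φ ∘ₗ S.μ.toLinearMap)

variable (S T : HopfGaloisStructure K L)

lemma twist_tmul (φ : L →ₗ[K] E) (c : E) (h : S.H) :
    S.twist φ (c ⊗ₜ h) = c • (φ ∘ₗ S.μ h) := rfl

lemma twist_tmul_apply (φ : L →ₗ[K] E) (c : E) (h : S.H) (l : L) :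
    S.twist φ (c ⊗ₜ h) l = c * φ (S.μ h l) := rfl

lemma twist_add_left (φ ψ : L →ₗ[K] E) (w : E ⊗[K] S.H) :
    S.twist (φ + ψ) w = S.twist φ w + S.twist ψ w := by
  induction w with
  | zero => simp
  | add x y hx hy => simp only [map_add, hx, hy]; abel
  | tmul c h => ext l; simp [twist_tmul_apply, mul_add]

lemma twist_smul_left (c : E) (φ : L →ₗ[K] E) (w : E ⊗[K] S.H) :
    S.twist (c • φ) w = c • S.twist φ w := by
  induction w with
  | zero => simp
  | add x y hx hy => simp only [map_add, hx, hy, smul_add]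
  | tmul c' h => ext l; simp [twist_tmul_apply]; ring

lemma twist_zero_left (w : E ⊗[K] S.H) : S.twist (0 : L →ₗ[K] E) w = 0 := by
  simpa using S.twist_smul_left 0 (0 : L →ₗ[K] E) w

lemma twist_mul (φ : L →ₗ[K] E) (w w' : E ⊗[K] S.H) :
    S.twist φ (w * w') = S.twist (S.twist φ w) w' := by
  induction w with
  | zero => simp [twist_zero_left]
  | add x y hx hy => simp only [add_mul, map_add, hx, hy, twist_add_left]
  | tmul c h =>
    induction w' with
    | zero => simp
    | add x y hx hy => simp only [mul_add, map_add, hx, hy]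
    | tmul c' h' =>
      ext l
      simp [twist_tmul_apply]
      ring

lemma twist_one (φ : L →ₗ[K] E) : S.twist φ 1 = φ := by
  ext l
  simp [Algebra.TensorProduct.one_def, twist_tmul_apply]

/-- The module algebra law after base change. For a group-like element it becomes multiplicativity,
which is why such elements send embeddings to embeddings. -/
lemma twist_apply_mul (x : L →ₐ[K] E) (w : E ⊗[K] S.H) (a b : L) :
    S.twist x.toLinearMap w (a * b) =
      LinearMap.mul' E E (TensorProduct.map ((S.twist x.toLinearMap).flip a)
        ((S.twist x.toLinearMap).flip b) (comul w)) := by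
  induction w with
  | zero => simp
  | add x y hx hy => simp only [map_add, LinearMap.add_apply, hx, hy]
  | tmul c h =>
    rw [twist_tmul_apply, S.map_mul, TensorProduct.comul_tmul, ← (ℛ K h).eq]
    simp [TensorProduct.tmul_sum, twist_tmul_apply, Finset.mul_sum, mul_left_comm]

lemma twist_apply_one (x : L →ₐ[K] E) (w : E ⊗[K] S.H) :
    S.twist x.toLinearMap w 1 = counit (R := E) w := by
  induction w with
  | zero => simp
  | add x y hx hy => simp only [map_add, LinearMap.add_apply, hx, hy]
  | tmul c h =>
    rw [twist_tmul_apply, S.map_one, TensorProduct.counit_tmul]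
    simp [Algebra.smul_def, mul_comm]

/-- A group-like element of `E ⊗ H` acts on the embeddings of `L` into `E`. -/
noncomputable def twistHom {g : E ⊗[K] S.H} (hg : IsGroupLikeElem E g) (x : L →ₐ[K] E) :
    L →ₐ[K] E :=
  AlgHom.ofLinearMap (S.twist x.toLinearMap g)
    (by rw [twist_apply_one, hg.counit_eq_one])
    (fun a b => by rw [twist_apply_mul, hg.comul_eq_tmul_self]; simp)

lemma twistHom_toLinearMap {g : E ⊗[K] S.H} (hg : IsGroupLikeElem E g) (x : L →ₐ[K] E) :
    (S.twistHom hg x).toLinearMap = S.twist x.toLinearMap g := rfl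

/-- This semilinearity is the source of the normalization by the Galois group. -/
lemma twist_galois (σ : E ≃ₐ[K] E) (x : L →ₐ[K] E) (w : E ⊗[K] S.H) :
    S.twist (embeddingPerm K L E σ x).toLinearMap
      (Algebra.TensorProduct.map σ.toAlgHom (AlgHom.id K S.H) w) =
      σ.toLinearMap ∘ₗ S.twist x.toLinearMap w := by
  induction w with
  | zero => simp
  | add x y hx hy => simp only [map_add, LinearMap.comp_add, hx, hy]
  | tmul c h => ext l; simp [twist_tmul_apply]

lemma μ_injective : Function.Injective S.μ := by
  intro a b h
  have h2 := S.bijective.1 (a₁ := 1 ⊗ₜ a) (a₂ := 1 ⊗ₜ b) (by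
    simp only [TensorProduct.lift.tmul, LinearMap.compl₁₂_apply, AlgHom.toLinearMap_apply, h])
  exact Algebra.TensorProduct.includeRight_injective (algebraMap K L).injective h2

lemma finrank_eq [FiniteDimensional K L] : Module.finrank K S.H = Module.finrank K L := by
  have h := (LinearEquiv.ofBijective _ S.bijective).finrank_eq
  rw [Module.finrank_tensorProduct, Module.finrank_linearMap] at h
  exact Nat.eq_of_mul_eq_mul_left Module.finrank_pos h

/-- Every `φ : L → E` is an `E`-combination of maps `x ∘ f` with `f` in `End_K(L)`, and each `f` is
a sum of terms `l • μ h` by the Hopf Galois condition. -/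
lemma twist_surjective [FiniteDimensional K L] (x : L →ₐ[K] E) :
    Function.Surjective (S.twist x.toLinearMap) := by
  have h1 : ∀ f : Module.End K L, x.toLinearMap ∘ₗ f ∈ LinearMap.range (S.twist x.toLinearMap) := by
    intro f
    obtain ⟨z, rfl⟩ := S.bijective.2 f
    induction z with
    | zero => simp
    | add a b ha hb => rw [map_add, LinearMap.comp_add]; exact add_mem ha hb
    | tmul l h =>
      refine ⟨x l ⊗ₜ h, ?_⟩
      ext l'
      simp [twist_tmul_apply]
  rw [← LinearMap.range_eq_top, eq_top_iff]
  intro φ _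
  let b := Module.finBasis K L
  have h2 : φ = ∑ i, φ (b i) • (x.toLinearMap ∘ₗ
      (Algebra.linearMap K L ∘ₗ b.coord i)) := by
    refine b.ext fun j => ?_
    simp [Finsupp.single_apply, Algebra.linearMap_apply]
  rw [h2]
  exact Submodule.sum_mem _ fun i _ => Submodule.smul_mem _ _ (h1 _)

lemma twist_injective [FiniteDimensional K L] (x : L →ₐ[K] E) :
    Function.Injective (S.twist x.toLinearMap) := by
  refine (LinearMap.injective_iff_surjective_of_finrank_eq_finrank ?_).2 (S.twist_surjective x)
  rw [Module.finrank_baseChange, finrank_eq, finrank_linearMap_field]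

variable (E) in
/-- The permutations of the embeddings of `L` into `E` induced by elements of `E ⊗ H`. -/
def permSet : Set (Equiv.Perm (L →ₐ[K] E)) :=
  {ρ | ∃ w : E ⊗[K] S.H, ∀ x, S.twist x.toLinearMap w = (ρ⁻¹ x).toLinearMap}

section OfType

variable {S} {N : Type*} [Group N] (e : (E ⊗[K] S.H) ≃ₐc[E] MonoidAlgebra E N)

lemma isGroupLikeElem_symm_of (n : N) :
    IsGroupLikeElem E (e.symm (MonoidAlgebra.of E N n)) :=
  (MonoidAlgebra.isGroupLikeElem_of n).map e.symm

lemma twistHom_twistHom_inv (n : N) (x : L →ₐ[K] E) :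
    S.twistHom (isGroupLikeElem_symm_of e n)
      (S.twistHom (isGroupLikeElem_symm_of e n⁻¹) x) = x := by
  apply AlgHom.toLinearMap_injective
  simp only [twistHom_toLinearMap]
  rw [← twist_mul, ← _root_.map_mul, ← _root_.map_mul, inv_mul_cancel, _root_.map_one, _root_.map_one, twist_one]

/-- The action of `N` on the embeddings of `L` into `E` that is defined by a Hopf Galois structure
of type `N`. -/
noncomputable def permHom : N →* Equiv.Perm (L →ₐ[K] E) where
  toFun n :=
    -- The twist is a right action, by `twist_mul`; the inverse turns it into a homomorphism.
    { toFun := S.twistHom (isGroupLikeElem_symm_of e n⁻¹)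
      invFun := S.twistHom (isGroupLikeElem_symm_of e n)
      left_inv := twistHom_twistHom_inv e n
      right_inv := fun x => by
        have := twistHom_twistHom_inv e n⁻¹ x
        simpa only [inv_inv] using this }
  map_one' := by
    ext1 x
    apply AlgHom.toLinearMap_injective
    simp only [Equiv.coe_fn_mk, twistHom_toLinearMap]
    rw [inv_one, _root_.map_one, _root_.map_one, twist_one]
    rfl
  map_mul' m n := by
    ext1 x
    apply AlgHom.toLinearMap_injective
    simp only [Equiv.coe_fn_mk, twistHom_toLinearMap, Equiv.Perm.mul_apply]
    rw [← twist_mul, ← _root_.map_mul, ← _root_.map_mul, mul_inv_rev]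

lemma permHom_apply (n : N) (x : L →ₐ[K] E) :
    (permHom e n x).toLinearMap = S.twist x.toLinearMap (e.symm (MonoidAlgebra.of E N n⁻¹)) := rfl

lemma permHom_inv_apply (n : N) (x : L →ₐ[K] E) :
    ((permHom e n)⁻¹ x).toLinearMap = S.twist x.toLinearMap (e.symm (MonoidAlgebra.of E N n)) :=
  rfl

lemma permHom_apply_injective [FiniteDimensional K L] (x : L →ₐ[K] E) :
    Function.Injective (fun n => permHom e n x) := by
  intro m n h
  have h1 := congrArg AlgHom.toLinearMap h
  simp only [permHom_apply] at h1
  exact inv_injective (MonoidAlgebra.of_injective (e.symm.injective (S.twist_injective x h1)))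

variable [FiniteDimensional K L] [Algebra.IsSeparable K L] [IsNormalClosure K L E]

lemma card_of_type (e : (E ⊗[K] S.H) ≃ₐc[E] MonoidAlgebra E N) : Nat.card N = Nat.card (L →ₐ[K] E) := by
  rw [card_embeddings, ← S.finrank_eq, ← Module.finrank_baseChange (R := E),
    e.toCoalgEquiv.toLinearEquiv.finrank_eq,
    Module.finrank_eq_nat_card_basis (MonoidAlgebra.basis N E)]

lemma permHom_apply_bijective (x : L →ₐ[K] E) :
    Function.Bijective (fun n => permHom e n x) :=
  have : Finite N := .of_injective _ (permHom_apply_injective e x)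
  (Nat.bijective_iff_injective_and_card _).2 ⟨permHom_apply_injective e x, card_of_type e⟩

/-- Since `N` is transitive on embeddings and the twist at `x` is injective, one embedding sent to
an embedding suffices to identify `w` as an element of `N`. -/
lemma exists_eq_symm_of_twist {x y : L →ₐ[K] E} {w : E ⊗[K] S.H}
    (h : S.twist x.toLinearMap w = y.toLinearMap) :
    ∃ n, w = e.symm (MonoidAlgebra.of E N n) := by
  obtain ⟨n, rfl⟩ := (permHom_apply_bijective e x).2 y
  exact ⟨n⁻¹, S.twist_injective x h⟩

/-- `permSet` is defined without `e`, so the group of permutations does not depend on the chosen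
isomorphism. -/
lemma mem_permSet_iff [Nonempty (L →ₐ[K] E)] {ρ : Equiv.Perm (L →ₐ[K] E)} :
    ρ ∈ S.permSet E ↔ ρ ∈ (permHom e).range := by
  constructor
  · rintro ⟨w, hw⟩
    obtain ⟨x⟩ := ‹Nonempty (L →ₐ[K] E)›
    obtain ⟨n, rfl⟩ := exists_eq_symm_of_twist e (hw x)
    refine ⟨n, inv_injective (Equiv.ext fun y => AlgHom.toLinearMap_injective ?_)⟩
    rw [permHom_inv_apply, hw]
  · rintro ⟨n, rfl⟩
    exact ⟨_, fun x => rfl⟩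

lemma permHom_galois [Nonempty (L →ₐ[K] E)] (σ : E ≃ₐ[K] E) (n : N) :
    ∃ m, embeddingPerm K L E σ * permHom e n * (embeddingPerm K L E σ)⁻¹ = permHom e m := by
  obtain ⟨x⟩ := ‹Nonempty (L →ₐ[K] E)›
  have key (z : L →ₐ[K] E) : S.twist (embeddingPerm K L E σ z).toLinearMap
      (Algebra.TensorProduct.map σ.toAlgHom (AlgHom.id K S.H)
        (e.symm (MonoidAlgebra.of E N n⁻¹))) =
      (embeddingPerm K L E σ (permHom e n z)).toLinearMap := by
    rw [twist_galois]
    rfl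
  obtain ⟨m, hm⟩ := exists_eq_symm_of_twist e (key x)
  refine ⟨m⁻¹, ?_⟩
  rw [mul_inv_eq_iff_eq_mul]
  ext1 z
  apply AlgHom.toLinearMap_injective
  rw [Equiv.Perm.mul_apply, ← key, hm, Equiv.Perm.mul_apply, permHom_apply, inv_inv]

end OfType

end HopfGaloisStructure

/-! ### The permutations determine the structure up to isomorphism -/

namespace HopfGaloisStructure

open Coalgebra

variable {K : Type u} {L : Type v} {E : Type w} [Field K] [Field L] [Field E]
  [Algebra K L] [Algebra K E] {S T : HopfGaloisStructure K L}

/-- The action of `H ⊗ H` on pairs of elements of `L` is faithful: bijectivity of `L ⊗ H → End_K(L)`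
removes the second variable, injectivity of `μ` the first. It lets the action determine the
comultiplication. -/
lemma tensor_eq_zero_of_action (z : T.H ⊗[K] T.H)
    (hz : ∀ a b : L, LinearMap.mul' K L (TensorProduct.map (T.μ.toLinearMap.flip a)
      (T.μ.toLinearMap.flip b) z) = 0) : z = 0 := by
  have h1 (a : L) : (T.μ.toLinearMap.flip a).rTensor T.H z = 0 := by
    apply T.bijective.1
    rw [map_zero]
    ext b
    rw [LinearMap.zero_apply, ← hz a b]
    generalize z = y
    induction y with
    | zero => simp
    | add x y hx hy => simp only [map_add, LinearMap.add_apply, hx, hy]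
    | tmul h h' => simp
  let β := Module.finBasis K T.H
  obtain ⟨c, rfl⟩ := TensorProduct.eq_repr_basis_right β z
  have h2 : c = 0 := by
    ext i
    apply T.μ_injective
    ext a
    have := h1 a
    rw [Finsupp.sum, map_sum] at this
    simp only [LinearMap.rTensor_tmul] at this
    have h3 := TensorProduct.sum_tmul_basis_right_eq_zero β
      (c.mapRange (T.μ.toLinearMap.flip a) (map_zero _)) (by
        rw [Finsupp.sum_mapRange_index (by simp)]
        exact this)
    simpa using DFunLike.congr_fun h3 i
  simp [h2]

/-- The images of both actions in `End_K(L)` have dimension `[L : K]`, so inclusion forces equality.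
The counit is read off from the action on `1`, the comultiplication from the action on products. -/
lemma iso_of_range_le [FiniteDimensional K L] (h : ∀ a : S.H, ∃ b : T.H, T.μ b = S.μ a) :
    S.Iso T := by
  have h' : S.μ.range = T.μ.range := by
    apply Subalgebra.toSubmodule_injective
    refine Submodule.eq_of_le_of_finrank_eq ?_ ?_
    · rintro _ ⟨a, rfl⟩
      exact h a
    · have e1 := (AlgEquiv.ofInjective S.μ S.μ_injective).toLinearEquiv.finrank_eq
      have e2 := (AlgEquiv.ofInjective T.μ T.μ_injective).toLinearEquiv.finrank_eq
      rw [finrank_eq] at e1 e2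
      exact e1.symm.trans e2
  let f : S.H ≃ₐ[K] T.H := (AlgEquiv.ofInjective S.μ S.μ_injective).trans
    ((Subalgebra.equivOfEq _ _ h').trans (AlgEquiv.ofInjective T.μ T.μ_injective).symm)
  have hf (a : S.H) : T.μ (f a) = S.μ a := by
    have := (AlgEquiv.ofInjective T.μ T.μ_injective).apply_symm_apply
      (Subalgebra.equivOfEq _ _ h' (AlgEquiv.ofInjective S.μ S.μ_injective a))
    exact congrArg Subtype.val this
  refine ⟨BialgEquiv.ofAlgEquiv f ?_ ?_, hf⟩
  · ext a
    apply (algebraMap K L).injective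
    have h1 := T.map_one (f a)
    rw [hf, S.map_one] at h1
    exact h1.symm
  · ext a
    rw [← sub_eq_zero]
    refine tensor_eq_zero_of_action _ fun x y => ?_
    rw [map_sub, map_sub, sub_eq_zero]
    have h1 := T.map_mul (f a) x y
    rw [hf, S.map_mul] at h1
    refine Eq.trans ?_ h1
    change LinearMap.mul' K L (TensorProduct.map _ _ (TensorProduct.map f.toLinearMap f.toLinearMap
      (comul a))) = _
    rw [← LinearMap.comp_apply (TensorProduct.map _ _), ← TensorProduct.map_comp]
    congr 2
    congr 1 <;>
    · ext b
      simp [hf]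

section Descent

variable [FiniteDimensional K L] [Algebra.IsSeparable K L] [IsNormalClosure K L E]

lemma twist_eq_comp_of_embeddings {f : Module.End K L} {w : E ⊗[K] T.H}
    (h : ∀ x : L →ₐ[K] E, x.toLinearMap ∘ₗ f = T.twist x.toLinearMap w) (φ : L →ₗ[K] E) :
    φ ∘ₗ f = T.twist φ w := by
  have hφ : φ ∈ Submodule.span E (Set.range (embeddingBasis K L E)) := by
    rw [Module.Basis.span_eq]; trivial
  induction hφ using Submodule.span_induction with
  | mem φ hφ =>
    obtain ⟨x, rfl⟩ := hφ
    rw [embeddingBasis_apply, h]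
  | zero => rw [twist_zero_left, LinearMap.zero_comp]
  | add a b _ _ ha hb => rw [LinearMap.add_comp, twist_add_left, ha, hb]
  | smul c a _ ha => rw [LinearMap.smul_comp, twist_smul_left, ha]

lemma exists_μ_eq_of_embeddings {f : Module.End K L} {w : E ⊗[K] T.H}
    (h : ∀ x : L →ₐ[K] E, x.toLinearMap ∘ₗ f = T.twist x.toLinearMap w) :
    ∃ a : T.H, T.μ a = f := by
  obtain ⟨ψ, hψ⟩ := LinearMap.exists_leftInverse_of_injective (Algebra.linearMap K E)
    (LinearMap.ker_eq_bot.2 (algebraMap K E).injective)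
  have hψ' (c : K) : ψ (algebraMap K E c) = c := LinearMap.congr_fun hψ c
  -- Applying a `K`-linear retraction `ψ : E → K` to the coefficients of `w` gives the element of
  -- `H`.
  refine ⟨TensorProduct.lid K T.H (ψ.rTensor T.H w), ?_⟩
  ext l
  rw [← sub_eq_zero, ← Module.forall_dual_apply_eq_zero_iff K]
  intro φ
  rw [map_sub, sub_eq_zero, ← hψ' (φ (f l))]
  have h1 := LinearMap.congr_fun (twist_eq_comp_of_embeddings h (Algebra.linearMap K E ∘ₗ φ)) l
  simp only [LinearMap.comp_apply, Algebra.linearMap_apply] at h1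
  rw [h1]
  generalize w = w'
  induction w' with
  | zero => simp
  | add x y hx hy => simp only [map_add, LinearMap.add_apply, hx, hy]
  | tmul c h =>
    rw [twist_tmul_apply, LinearMap.comp_apply, Algebra.linearMap_apply, mul_comm,
      ← Algebra.smul_def, map_smul]
    simp [mul_comm]

/-- The group-like elements span `E ⊗ S.H`, so each of its elements acts like some element of `E ⊗
T.H`; for elements of `S.H` this descends to `K`. -/
lemma iso_of_permSet_subset {N : Type*} [Group N] (e : (E ⊗[K] S.H) ≃ₐc[E] MonoidAlgebra E N)
    (h : S.permSet E ⊆ T.permSet E) : S.Iso T := by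
  refine iso_of_range_le fun a => ?_
  have key (m : MonoidAlgebra E N) : ∃ w' : E ⊗[K] T.H, ∀ x : L →ₐ[K] E,
      S.twist x.toLinearMap (e.symm m) = T.twist x.toLinearMap w' := by
    induction m using MonoidAlgebra.induction_on with
    | of n =>
      obtain ⟨w', hw'⟩ := h (a := (permHom e n)) ⟨_, fun x => (permHom_inv_apply e n x).symm⟩
      exact ⟨w', fun x => (permHom_inv_apply e n x).symm.trans (hw' x).symm⟩
    | add a b ha hb =>
      obtain ⟨a', ha'⟩ := ha
      obtain ⟨b', hb'⟩ := hb
      exact ⟨a' + b', fun x => by simp only [map_add, ha', hb']⟩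
    | smul c a ha =>
      obtain ⟨a', ha'⟩ := ha
      exact ⟨c • a', fun x => by simp only [map_smul, ha']⟩
  obtain ⟨w', hw'⟩ := key (e (1 ⊗ₜ a))
  refine exists_μ_eq_of_embeddings (w := w') fun x => ?_
  rw [← hw', BialgEquiv.symm_apply_apply, twist_tmul, one_smul]

end Descent

lemma permSet_subset_of_iso (h : S.Iso T) : S.permSet E ⊆ T.permSet E := by
  obtain ⟨e, he⟩ := h
  rintro ρ ⟨w, hw⟩
  refine ⟨e.toCoalgEquiv.toLinearEquiv.toLinearMap.lTensor E w, fun x => ?_⟩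
  rw [← hw x]
  generalize w = w'
  induction w' with
  | zero => simp
  | add x y hx hy => simp only [map_add, hx, hy]
  | tmul c h =>
    rw [LinearMap.lTensor_tmul, twist_tmul, twist_tmul, ← he h]
    rfl

end HopfGaloisStructure

/-! ### Galois descent for vector spaces -/

section GaloisDescent

variable {K E V : Type*} [Field K] [Field E] [Algebra K E] [AddCommGroup V] [Module E V]
  [Module K V] [IsScalarTower K E V]

/-- The fixed vectors of a semilinear action of the Galois group. -/
def semilinearFixed (s : (E ≃ₐ[K] E) →* AddMonoid.End V)
    (hs : ∀ σ (c : E) (v : V), s σ (c • v) = σ c • s σ v) : Submodule K V where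
  carrier := {v | ∀ σ, s σ v = v}
  add_mem' ha hb σ := by rw [map_add, ha σ, hb σ]
  zero_mem' σ := map_zero _
  smul_mem' c v hv σ := by
    rw [← algebraMap_smul E c v, hs, hv σ, AlgEquiv.commutes]

variable [FiniteDimensional K E]
  {s : (E ≃ₐ[K] E) →* AddMonoid.End V}
  {hs : ∀ σ (c : E) (v : V), s σ (c • v) = σ c • s σ v}

/-- Multiplying a relation by `c` and summing its Galois conjugates gives a relation over `K` whose
coefficients are traces. These vanish for every `c`, and the trace form is nondegenerate. -/
lemma linearIndependent_of_semilinearFixed [IsGalois K E] {ι : Type*} {b : ι → semilinearFixed s hs}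
    (hb : LinearIndependent K b) : LinearIndependent E (fun i => (b i : V)) := by
  rw [linearIndependent_iff']
  intro t g hg i hi
  have key (c : E) : Algebra.trace K E (c * g i) = 0 := by
    have h1 : ∑ i ∈ t, Algebra.trace K E (c * g i) • b i = 0 := by
      apply Subtype.ext
      simp only [Submodule.coe_sum, Submodule.coe_smul, Submodule.coe_zero]
      have h2 (σ : E ≃ₐ[K] E) : ∑ i ∈ t, σ (c * g i) • (b i : V) = 0 := by
        have h3 : s σ (c • ∑ i ∈ t, g i • (b i : V)) = 0 := by rw [hg, smul_zero, map_zero]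
        rw [Finset.smul_sum, map_sum] at h3
        rw [← h3]
        refine Finset.sum_congr rfl fun i _ => ?_
        rw [smul_smul, hs, (b i).2 σ]
      calc ∑ i ∈ t, Algebra.trace K E (c * g i) • (b i : V)
          = ∑ i ∈ t, ∑ σ : E ≃ₐ[K] E, σ (c * g i) • (b i : V) := by
            refine Finset.sum_congr rfl fun i _ => ?_
            rw [← Finset.sum_smul, ← trace_eq_sum_automorphisms, algebraMap_smul]
        _ = 0 := by rw [Finset.sum_comm]; exact Finset.sum_eq_zero fun σ _ => h2 σ
    exact linearIndependent_iff'.1 hb t _ h1 i hi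
  refine (traceForm_nondegenerate K E).1 (g i) fun c => ?_
  rw [Algebra.traceForm_apply, mul_comm]
  exact key c

/-- A functional that kills the fixed vectors kills every `∑ σ, s σ (c • v)`; Dedekind's
independence of automorphisms then makes it vanish at `v`. -/
lemma span_semilinearFixed : Submodule.span E (semilinearFixed s hs : Set V) = ⊤ := by
  rw [eq_top_iff]
  intro v _
  by_contra hv
  obtain ⟨f, hf, hle⟩ := Submodule.exists_le_ker_of_notMem hv
  have key (c : E) : ∑ σ : E ≃ₐ[K] E, σ c * f (s σ v) = 0 := by
    have h1 : ∑ σ : E ≃ₐ[K] E, s σ (c • v) ∈ semilinearFixed s hs := by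
      intro τ
      rw [map_sum]
      refine Fintype.sum_equiv (Equiv.mulLeft τ) _ _ fun σ => ?_
      rw [Equiv.coe_mulLeft, map_mul]
      rfl
    have h2 : f (∑ σ : E ≃ₐ[K] E, s σ (c • v)) = 0 := hle (Submodule.subset_span h1)
    rw [map_sum] at h2
    simpa only [hs, map_smul, smul_eq_mul] using h2
  have hli := (linearIndependent_monoidHom E E).comp
    (fun σ : E ≃ₐ[K] E => (σ : E →* E)) (fun σ τ h => AlgEquiv.ext fun c =>
      DFunLike.congr_fun (F := E →* E) h c)
  have h3 := Fintype.linearIndependent_iff.1 hli (fun σ => f (s σ v)) (by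
    funext c
    simpa [mul_comm] using key c) 1
  rw [map_one] at h3
  exact hf h3

variable (hs) in
/-- Galois descent: the fixed vectors of a semilinear action have a basis over `K` that is a basis
of the whole space over `E`. -/
lemma exists_basis_semilinearFixed [IsGalois K E] [FiniteDimensional E V] :
    ∃ (n : ℕ) (b : Module.Basis (Fin n) K (semilinearFixed s hs)) (B : Module.Basis (Fin n) E V),
      ∀ i, B i = b i := by
  let b := Module.Basis.ofVectorSpace K (semilinearFixed s hs)
  have hspan : ⊤ ≤ Submodule.span E (Set.range fun i => (b i : V)) := by
    rw [← span_semilinearFixed (hs := hs), Submodule.span_le]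
    intro v hv
    have h1 : (⟨v, hv⟩ : semilinearFixed s hs) ∈ Submodule.span K (Set.range b) := by
      rw [b.span_eq]; trivial
    have h2 := Submodule.mem_map_of_mem (f := (semilinearFixed s hs).subtype) h1
    rw [Submodule.map_span, ← Set.range_comp] at h2
    exact Submodule.span_le_restrictScalars K E _ h2
  let B := Module.Basis.mk (linearIndependent_of_semilinearFixed b.linearIndependent) hspan
  have : Finite (Module.Basis.ofVectorSpaceIndex K (semilinearFixed s hs)) :=
    Module.Finite.finite_basis B
  let ε := Finite.equivFin (Module.Basis.ofVectorSpaceIndex K (semilinearFixed s hs))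
  exact ⟨_, b.reindex ε, B.reindex ε, fun i => by
    rw [Module.Basis.reindex_apply, Module.Basis.reindex_apply, Module.Basis.mk_apply]⟩

end GaloisDescent

/-! ### Descent of Hopf algebra structures -/

section HopfDescent

variable {K E : Type*} [Field K] [Field E] [Algebra K E]

section Linear

variable {M P M' P' ι ι' : Type*} [AddCommGroup M] [Module K M] [AddCommGroup M'] [Module K M']
  [AddCommGroup P] [Module E P] [Module K P] [IsScalarTower K E P]
  [AddCommGroup P'] [Module E P'] [Module K P'] [IsScalarTower K E P']

lemma injective_of_basis (f : M →ₗ[K] P) (b : Module.Basis ι K M) (B : Module.Basis ι E P)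
    (h : ∀ i, B i = f (b i)) : Function.Injective f := by
  have h1 : LinearIndependent K (f ∘ b) := by
    have := B.linearIndependent.restrict_scalars' K
    rwa [show (B : ι → P) = f ∘ b from funext h] at this
  have h2 : f = Finsupp.linearCombination K (f ∘ b) ∘ₗ b.repr.toLinearMap :=
    b.ext fun i => by simp
  rw [h2]
  intro x y hxy
  exact b.repr.injective (h1 hxy)

lemma mem_range_of_repr [Fintype ι] (f : M →ₗ[K] P) (b : Module.Basis ι K M)
    (B : Module.Basis ι E P) (h : ∀ i, B i = f (b i)) {p : P}
    (hp : ∀ i, ∃ c : K, algebraMap K E c = B.repr p i) : p ∈ LinearMap.range f := by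
  rw [← B.sum_repr p]
  refine Submodule.sum_mem _ fun i _ => ?_
  obtain ⟨c, hc⟩ := hp i
  rw [← hc, algebraMap_smul, h]
  exact Submodule.smul_mem _ _ ⟨_, rfl⟩

/-- The tensor product of two maps from `K`-modules to `E`-modules. -/
noncomputable def mapTensorTower (f : M →ₗ[K] P) (g : M' →ₗ[K] P') :
    M ⊗[K] M' →ₗ[K] P ⊗[E] P' :=
  TensorProduct.lift (((TensorProduct.mk E P P').restrictScalars₁₂ K K).compl₁₂ f g)

@[simp]
lemma mapTensorTower_tmul (f : M →ₗ[K] P) (g : M' →ₗ[K] P') (x : M) (y : M') :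
    mapTensorTower (E := E) f g (x ⊗ₜ y) = f x ⊗ₜ g y := rfl

lemma mapTensorTower_basis (f : M →ₗ[K] P) (g : M' →ₗ[K] P') (b : Module.Basis ι K M)
    (B : Module.Basis ι E P) (h : ∀ i, B i = f (b i)) (b' : Module.Basis ι' K M')
    (B' : Module.Basis ι' E P') (h' : ∀ i, B' i = g (b' i)) (i : ι × ι') :
    B.tensorProduct B' i = mapTensorTower (E := E) f g (b.tensorProduct b' i) := by
  rw [Module.Basis.tensorProduct_apply', Module.Basis.tensorProduct_apply', mapTensorTower_tmul,
    h, h']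

/-- The factorization of a linear map through an injective map. -/
noncomputable def LinearMap.factorThrough (f : M →ₗ[K] P) (hf : Function.Injective f)
    (g : M' →ₗ[K] P) (h : ∀ x, g x ∈ LinearMap.range f) : M' →ₗ[K] M :=
  (LinearEquiv.ofInjective f hf).symm.toLinearMap ∘ₗ g.codRestrict _ h

lemma LinearMap.apply_factorThrough (f : M →ₗ[K] P) (hf : Function.Injective f)
    (g : M' →ₗ[K] P) (h : ∀ x, g x ∈ LinearMap.range f) (x : M') :
    f (LinearMap.factorThrough f hf g h x) = g x :=
  congrArg Subtype.val ((LinearEquiv.ofInjective f hf).apply_symm_apply (g.codRestrict _ h x))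

end Linear

variable {A H : Type*} [Ring A] [HopfAlgebra E A] [Algebra K A] [IsScalarTower K E A]
  [Ring H] [Algebra K H]

/-- The map `H ⊗ H → A ⊗ A` induced by a map `H → A` from a `K`-algebra to an `E`-algebra. -/
noncomputable def tensorSquareMap (j : H →ₐ[K] A) : H ⊗[K] H →ₗ[K] A ⊗[E] A :=
  mapTensorTower (E := E) j.toLinearMap j.toLinearMap

lemma tensorSquareMap_tmul (j : H →ₐ[K] A) (x y : H) :
    tensorSquareMap (E := E) j (x ⊗ₜ y) = j x ⊗ₜ j y := rfl

lemma tensorSquareMap_mul (j : H →ₐ[K] A) (z z' : H ⊗[K] H) :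
    tensorSquareMap (E := E) j (z * z') = tensorSquareMap j z * tensorSquareMap j z' := by
  induction z with
  | zero => simp
  | add x y hx hy => simp only [add_mul, map_add, hx, hy]
  | tmul x y =>
    induction z' with
    | zero => simp
    | add x y hx hy => simp only [mul_add, map_add, hx, hy]
    | tmul x' y' => simp [tensorSquareMap_tmul]

variable (K E A H) in
/-- A `K`-form `H` of the `E`-Hopf algebra `A`: an algebra map `j : H → A` that takes a `K`-basis
of `H` to an `E`-basis of `A`, and whose image is stable under the Hopf algebra operations. -/
structure HopfForm where
  /-- the inclusion -/
  j : H →ₐ[K] A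
  /-- the dimension -/
  n : ℕ
  /-- a basis of `H` -/
  b : Module.Basis (Fin n) K H
  /-- its image in `A` -/
  B : Module.Basis (Fin n) E A
  basis_eq : ∀ i, B i = j (b i)
  comul_mem : ∀ h, Coalgebra.comul (R := E) (j h) ∈ LinearMap.range (tensorSquareMap (E := E) j)
  counit_mem : ∀ h, Coalgebra.counit (R := E) (j h) ∈ LinearMap.range (Algebra.linearMap K E)
  antipode_mem : ∀ h, HopfAlgebra.antipode E (j h) ∈ LinearMap.range j.toLinearMap

namespace HopfForm

open Coalgebra

variable (D : HopfForm K E A H)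

lemma j_injective : Function.Injective D.j :=
  injective_of_basis D.j.toLinearMap D.b D.B D.basis_eq

lemma tensorSquareMap_basis (i : Fin D.n × Fin D.n) :
    D.B.tensorProduct D.B i = tensorSquareMap (E := E) D.j (D.b.tensorProduct D.b i) :=
  mapTensorTower_basis _ _ _ _ D.basis_eq _ _ D.basis_eq i

lemma tensorSquareMap_injective : Function.Injective (tensorSquareMap (E := E) D.j) :=
  injective_of_basis _ _ _ D.tensorSquareMap_basis

/-- The map `H ⊗ (H ⊗ H) → A ⊗ (A ⊗ A)`. -/
noncomputable def tensorCubeMap : H ⊗[K] (H ⊗[K] H) →ₗ[K] A ⊗[E] (A ⊗[E] A) :=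
  mapTensorTower (E := E) D.j.toLinearMap (tensorSquareMap (E := E) D.j)

lemma tensorCubeMap_tmul (x : H) (z : H ⊗[K] H) :
    D.tensorCubeMap (x ⊗ₜ z) = D.j x ⊗ₜ tensorSquareMap D.j z := rfl

lemma tensorCubeMap_injective : Function.Injective D.tensorCubeMap :=
  injective_of_basis _ _ _
    (mapTensorTower_basis _ _ _ _ D.basis_eq _ _ D.tensorSquareMap_basis)

/-- The comultiplication of the form. -/
noncomputable def comulMap : H →ₗ[K] H ⊗[K] H :=
  LinearMap.factorThrough _ D.tensorSquareMap_injective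
    ((comul (R := E) (A := A)).restrictScalars K ∘ₗ D.j.toLinearMap) D.comul_mem

lemma tensorSquareMap_comulMap (h : H) :
    tensorSquareMap D.j (D.comulMap h) = comul (R := E) (D.j h) :=
  LinearMap.apply_factorThrough _ _ _ _ h

/-- The counit of the form. -/
noncomputable def counitMap : H →ₗ[K] K :=
  LinearMap.factorThrough (Algebra.linearMap K E) (algebraMap K E).injective
    ((counit (R := E) (A := A)).restrictScalars K ∘ₗ D.j.toLinearMap) D.counit_mem

lemma algebraMap_counitMap (h : H) :
    algebraMap K E (D.counitMap h) = counit (R := E) (D.j h) :=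
  LinearMap.apply_factorThrough (Algebra.linearMap K E) _ _ _ h

/-- The antipode of the form. -/
noncomputable def antipodeMap : H →ₗ[K] H :=
  LinearMap.factorThrough D.j.toLinearMap D.j_injective
    ((HopfAlgebra.antipode E (A := A)).restrictScalars K ∘ₗ D.j.toLinearMap) D.antipode_mem

lemma j_antipodeMap (h : H) : D.j (D.antipodeMap h) = HopfAlgebra.antipode E (D.j h) :=
  LinearMap.apply_factorThrough D.j.toLinearMap _ _ _ h

lemma tensorCubeMap_assoc (z : H ⊗[K] H) (y : H) :
    D.tensorCubeMap (TensorProduct.assoc K H H H (z ⊗ₜ y)) =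
      TensorProduct.assoc E A A A (tensorSquareMap D.j z ⊗ₜ D.j y) := by
  induction z with
  | zero => simp
  | add x y hx hy => simp only [TensorProduct.add_tmul, map_add, hx, hy]
  | tmul x x' => simp [tensorCubeMap_tmul, tensorSquareMap_tmul]

/-- The coalgebra structure of the form. -/
@[reducible]
noncomputable def coalgebra : Coalgebra K H where
  comul := D.comulMap
  counit := D.counitMap
  coassoc := by
    ext h
    -- Here and below, an identity in the form is checked in `A` or its tensor powers, into which
    -- the form injects.
    apply D.tensorCubeMap_injective
    have h1 (z : H ⊗[K] H) : D.tensorCubeMap (TensorProduct.assoc K H H H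
        (D.comulMap.rTensor H z)) = TensorProduct.assoc E A A A
          ((comul (R := E) (A := A)).rTensor A (tensorSquareMap D.j z)) := by
      induction z with
      | zero => simp
      | add x y hx hy => simp only [map_add, hx, hy]
      | tmul x y =>
        rw [LinearMap.rTensor_tmul, tensorCubeMap_assoc, tensorSquareMap_comulMap,
          tensorSquareMap_tmul, LinearMap.rTensor_tmul]
    have h2 (z : H ⊗[K] H) : D.tensorCubeMap (D.comulMap.lTensor H z) =
        (comul (R := E) (A := A)).lTensor A (tensorSquareMap D.j z) := by
      induction z with
      | zero => simp
      | add x y hx hy => simp only [map_add, hx, hy]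
      | tmul x y =>
        rw [LinearMap.lTensor_tmul, tensorCubeMap_tmul, tensorSquareMap_comulMap,
          tensorSquareMap_tmul, LinearMap.lTensor_tmul]
    simp only [LinearMap.comp_apply, LinearEquiv.coe_coe]
    rw [h1, h2, tensorSquareMap_comulMap, Coalgebra.coassoc_apply]
  rTensor_counit_comp_comul := by
    ext h
    apply (TensorProduct.lid K H).injective
    apply D.j_injective
    have h1 (z : H ⊗[K] H) : D.j (TensorProduct.lid K H (D.counitMap.rTensor H z)) =
        TensorProduct.lid E A ((counit (R := E) (A := A)).rTensor A (tensorSquareMap D.j z)) := by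
      induction z with
      | zero => simp
      | add x y hx hy => simp only [map_add, hx, hy]
      | tmul x y =>
        rw [LinearMap.rTensor_tmul, TensorProduct.lid_tmul, tensorSquareMap_tmul,
          LinearMap.rTensor_tmul, TensorProduct.lid_tmul, ← algebraMap_counitMap, map_smul,
          algebraMap_smul]
    simp only [LinearMap.comp_apply]
    rw [h1, tensorSquareMap_comulMap, Coalgebra.rTensor_counit_comul]
    simp
  lTensor_counit_comp_comul := by
    ext h
    apply (TensorProduct.rid K H).injective
    apply D.j_injective
    have h1 (z : H ⊗[K] H) : D.j (TensorProduct.rid K H (D.counitMap.lTensor H z)) =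
        TensorProduct.rid E A ((counit (R := E) (A := A)).lTensor A (tensorSquareMap D.j z)) := by
      induction z with
      | zero => simp
      | add x y hx hy => simp only [map_add, hx, hy]
      | tmul x y =>
        rw [LinearMap.lTensor_tmul, TensorProduct.rid_tmul, tensorSquareMap_tmul,
          LinearMap.lTensor_tmul, TensorProduct.rid_tmul, ← algebraMap_counitMap, map_smul,
          algebraMap_smul]
    simp only [LinearMap.comp_apply]
    rw [h1, tensorSquareMap_comulMap, Coalgebra.lTensor_counit_comul]
    simp

/-- The bialgebra structure of the form. -/
@[reducible]
noncomputable def bialgebra : Bialgebra K H :=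
  letI := D.coalgebra
  Bialgebra.mk' K H
    (by
      apply (algebraMap K E).injective
      exact (D.algebraMap_counitMap 1).trans (by simp))
    (by
      intro a b
      apply (algebraMap K E).injective
      refine (D.algebraMap_counitMap _).trans ?_
      rw [map_mul D.j, Bialgebra.counit_mul, map_mul (algebraMap K E)]
      exact (congrArg₂ _ (D.algebraMap_counitMap a) (D.algebraMap_counitMap b)).symm)
    (by
      apply D.tensorSquareMap_injective
      refine (D.tensorSquareMap_comulMap _).trans ?_
      rw [map_one, Bialgebra.comul_one, Algebra.TensorProduct.one_def,
        Algebra.TensorProduct.one_def, tensorSquareMap_tmul, map_one])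
    (by
      intro a b
      apply D.tensorSquareMap_injective
      refine (D.tensorSquareMap_comulMap _).trans ?_
      rw [map_mul, Bialgebra.comul_mul, tensorSquareMap_mul]
      exact (congrArg₂ _ (D.tensorSquareMap_comulMap a) (D.tensorSquareMap_comulMap b)).symm)

/-- The Hopf algebra structure of the form. -/
@[reducible]
noncomputable def hopfAlgebra : HopfAlgebra K H :=
  letI := D.bialgebra
  { antipode := D.antipodeMap
    mul_antipode_rTensor_comul := by
      ext h
      apply D.j_injective
      have h1 (z : H ⊗[K] H) : D.j (LinearMap.mul' K H (D.antipodeMap.rTensor H z)) =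
          LinearMap.mul' E A ((HopfAlgebra.antipode E (A := A)).rTensor A
            (tensorSquareMap D.j z)) := by
        induction z with
        | zero => simp
        | add x y hx hy => simp only [map_add, hx, hy]
        | tmul x y => simp [tensorSquareMap_tmul, j_antipodeMap]
      refine (h1 (D.comulMap h)).trans ?_
      rw [tensorSquareMap_comulMap, HopfAlgebra.mul_antipode_rTensor_comul_apply,
        ← algebraMap_counitMap, ← IsScalarTower.algebraMap_apply]
      exact (D.j.commutes _).symm
    mul_antipode_lTensor_comul := by
      ext h
      apply D.j_injective
      have h1 (z : H ⊗[K] H) : D.j (LinearMap.mul' K H (D.antipodeMap.lTensor H z)) =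
          LinearMap.mul' E A ((HopfAlgebra.antipode E (A := A)).lTensor A
            (tensorSquareMap D.j z)) := by
        induction z with
        | zero => simp
        | add x y hx hy => simp only [map_add, hx, hy]
        | tmul x y => simp [tensorSquareMap_tmul, j_antipodeMap]
      refine (h1 (D.comulMap h)).trans ?_
      rw [tensorSquareMap_comulMap, HopfAlgebra.mul_antipode_lTensor_comul_apply,
        ← algebraMap_counitMap, ← IsScalarTower.algebraMap_apply]
      exact (D.j.commutes _).symm }

lemma isCocomm [IsCocomm E A] : letI := D.hopfAlgebra; IsCocomm K H := by
  let := D.hopfAlgebra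
  refine ⟨?_⟩
  ext h
  apply D.tensorSquareMap_injective
  have h1 (z : H ⊗[K] H) : tensorSquareMap (E := E) D.j (TensorProduct.comm K H H z) =
      TensorProduct.comm E A A (tensorSquareMap D.j z) := by
    induction z with
    | zero => simp
    | add x y hx hy => simp only [map_add, hx, hy]
    | tmul x y => simp [tensorSquareMap_tmul]
  refine (h1 (D.comulMap h)).trans ?_
  rw [tensorSquareMap_comulMap, Coalgebra.comm_comul]
  exact (D.tensorSquareMap_comulMap h).symm

/-- The map `E ⊗ H → A`. -/
noncomputable def baseChangeHom : E ⊗[K] H →ₐ[E] A :=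
  Algebra.TensorProduct.lift (Algebra.ofId E A) D.j fun c h => Algebra.commutes c (D.j h)

lemma baseChangeHom_tmul (c : E) (h : H) : D.baseChangeHom (c ⊗ₜ h) = c • D.j h := by
  rw [Algebra.smul_def]
  exact Algebra.TensorProduct.lift_tmul (Algebra.ofId E A) D.j _ c h

lemma baseChangeHom_bijective : Function.Bijective D.baseChangeHom := by
  have h : D.baseChangeHom.toLinearMap =
      ((Algebra.TensorProduct.basis E D.b).equiv D.B (Equiv.refl _)).toLinearMap := by
    refine (Algebra.TensorProduct.basis E D.b).ext fun i => ?_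
    rw [LinearEquiv.coe_coe, Module.Basis.equiv_apply, Equiv.refl_apply, D.basis_eq,
      Algebra.TensorProduct.basis_apply, AlgHom.toLinearMap_apply, baseChangeHom_tmul, one_smul]
  have h2 : ⇑D.baseChangeHom = ((Algebra.TensorProduct.basis E D.b).equiv D.B (Equiv.refl _)) :=
    congrArg DFunLike.coe h
  rw [h2]
  exact LinearEquiv.bijective _

/-- The base change of the form is the original Hopf algebra. -/
noncomputable def baseChangeEquiv : letI := D.hopfAlgebra; (E ⊗[K] H) ≃ₐc[E] A :=
  letI := D.hopfAlgebra
  BialgEquiv.ofAlgEquiv (AlgEquiv.ofBijective D.baseChangeHom D.baseChangeHom_bijective)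
    (by
      ext h
      simp [baseChangeHom_tmul, Algebra.smul_def]
      exact (D.algebraMap_counitMap h).symm)
    (by
      ext h
      have h1 (z : H ⊗[K] H) : TensorProduct.map D.baseChangeHom.toLinearMap
          D.baseChangeHom.toLinearMap
          (TensorProduct.AlgebraTensorModule.tensorTensorTensorComm K E K E E E H H
            ((1 ⊗ₜ[E] 1) ⊗ₜ[K] z)) = tensorSquareMap D.j z := by
        induction z with
        | zero => simp
        | add x y hx hy => simp only [TensorProduct.tmul_add, map_add, hx, hy]
        | tmul x y => simp [tensorSquareMap_tmul, baseChangeHom_tmul]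
      have h2 := h1 (D.comulMap h)
      rw [tensorSquareMap_comulMap] at h2
      have h3 : D.baseChangeHom (1 ⊗ₜ h) = D.j h := by rw [baseChangeHom_tmul, one_smul]
      rw [← h3] at h2
      exact h2)

lemma baseChangeEquiv_tmul (c : E) (h : H) :
    letI := D.hopfAlgebra
    D.baseChangeEquiv (c ⊗ₜ h) = c • D.j h :=
  D.baseChangeHom_tmul c h

end HopfForm

end HopfDescent

/-! ### The fixed algebra of a twisted group algebra -/

section TwistedForm

open MonoidAlgebra

variable {K : Type u} {E : Type w} [Field K] [Field E] [Algebra K E] {N : Type*} [Group N]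
  (α : (E ≃ₐ[K] E) →* MulAut N)

/-- The semilinear ring endomorphism of `E[N]` defined by an element of the Galois group. -/
noncomputable def galoisTwistRingHom (σ : E ≃ₐ[K] E) : MonoidAlgebra E N →+* MonoidAlgebra E N :=
  (mapRingHom N (σ : E →+* E)).comp (mapDomainRingHom E (α σ : N →* N))

lemma galoisTwistRingHom_single (σ : E ≃ₐ[K] E) (n : N) (c : E) :
    galoisTwistRingHom α σ (single n c) = single (α σ n) (σ c) := by
  simp [galoisTwistRingHom]

/-- The semilinear action of the Galois group on `E[N]` defined by an action on `N`. -/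
noncomputable def galoisTwist : (E ≃ₐ[K] E) →* AddMonoid.End (MonoidAlgebra E N) where
  toFun σ := (galoisTwistRingHom α σ).toAddMonoidHom
  map_one' := by
    refine AddMonoidHom.ext fun a => ?_
    change galoisTwistRingHom α 1 a = a
    induction a using MonoidAlgebra.induction_linear with
    | zero => rw [map_zero]
    | add x y hx hy => rw [map_add, hx, hy]
    | single m r => simp [galoisTwistRingHom_single]
  map_mul' σ τ := by
    refine AddMonoidHom.ext fun a => ?_
    change galoisTwistRingHom α (σ * τ) a = galoisTwistRingHom α σ (galoisTwistRingHom α τ a)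
    induction a using MonoidAlgebra.induction_linear with
    | zero => simp only [map_zero]
    | add x y hx hy => simp only [map_add, hx, hy]
    | single m r => simp [galoisTwistRingHom_single]

@[simp]
lemma galoisTwist_single (σ : E ≃ₐ[K] E) (n : N) (c : E) :
    galoisTwist α σ (single n c) = single (α σ n) (σ c) :=
  galoisTwistRingHom_single α σ n c

lemma galoisTwist_mul (σ : E ≃ₐ[K] E) (a b : MonoidAlgebra E N) :
    galoisTwist α σ (a * b) = galoisTwist α σ a * galoisTwist α σ b :=
  map_mul (galoisTwistRingHom α σ) a b

lemma galoisTwist_smul (σ : E ≃ₐ[K] E) (c : E) (a : MonoidAlgebra E N) :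
    galoisTwist α σ (c • a) = σ c • galoisTwist α σ a := by
  induction a using MonoidAlgebra.induction_linear with
  | zero => simp
  | add x y hx hy => rw [smul_add, map_add, hx, hy, map_add, smul_add]
  | single m r => simp [smul_single]

/-- The fixed algebra `E[N]^G`. -/
noncomputable def fixedAlgebra : Subalgebra K (MonoidAlgebra E N) :=
  { semilinearFixed (galoisTwist α) (galoisTwist_smul α) with
    mul_mem' := fun {a b} ha hb σ => by rw [galoisTwist_mul, ha σ, hb σ]
    algebraMap_mem' := fun c σ => by
      rw [IsScalarTower.algebraMap_apply K E, MonoidAlgebra.coe_algebraMap]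
      simp }

lemma counit_galoisTwist (σ : E ≃ₐ[K] E) (a : MonoidAlgebra E N) :
    Coalgebra.counit (R := E) (galoisTwist α σ a) = σ (Coalgebra.counit (R := E) a) := by
  induction a using MonoidAlgebra.induction_linear with
  | zero => simp
  | add x y hx hy => rw [map_add, map_add, hx, hy, map_add, map_add]
  | single m r => simp

lemma antipode_galoisTwist (σ : E ≃ₐ[K] E) (a : MonoidAlgebra E N) :
    HopfAlgebra.antipode E (galoisTwist α σ a) = galoisTwist α σ (HopfAlgebra.antipode E a) := by
  induction a using MonoidAlgebra.induction_linear with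
  | zero => simp
  | add x y hx hy => rw [map_add, map_add, hx, hy, map_add, map_add]
  | single m r => simp

lemma repr_galoisTwist {ι : Type*} (B : Module.Basis ι E (MonoidAlgebra E N))
    (hB : ∀ i, B i ∈ fixedAlgebra α) (σ : E ≃ₐ[K] E) (a : MonoidAlgebra E N) (i : ι) :
    B.repr (galoisTwist α σ a) i = σ (B.repr a i) := by
  have ha : a ∈ Submodule.span E (Set.range B) := by rw [B.span_eq]; trivial
  induction ha using Submodule.span_induction with
  | mem x hx =>
    obtain ⟨k, rfl⟩ := hx
    classical
    rw [hB k σ, B.repr_self, Finsupp.single_apply]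
    split_ifs <;> simp
  | zero => simp
  | add x y _ _ hx hy => simp only [map_add, Finsupp.add_apply, hx, hy]
  | smul c x _ hx => rw [galoisTwist_smul]; simp [hx]

/-- For fixed `a`, the coordinates of its comultiplication in a fixed basis are Galois invariant and
so lie in `K`: the comultiplication descends. -/
lemma repr_comul_galoisTwist {ι : Type*} (B : Module.Basis ι E (MonoidAlgebra E N))
    (hB : ∀ i, B i ∈ fixedAlgebra α) (σ : E ≃ₐ[K] E) (a : MonoidAlgebra E N) (i : ι × ι) :
    (B.tensorProduct B).repr (Coalgebra.comul (R := E) (galoisTwist α σ a)) i =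
      σ ((B.tensorProduct B).repr (Coalgebra.comul (R := E) a) i) := by
  obtain ⟨i, k⟩ := i
  induction a using MonoidAlgebra.induction_on with
  | of n =>
    have h (m : N) : Coalgebra.comul (R := E) (single m (1 : E)) = single m 1 ⊗ₜ[E] single m 1 := by
      simp
    rw [of_apply, galoisTwist_single, map_one, h, h, Module.Basis.tensorProduct_repr_tmul_apply,
      Module.Basis.tensorProduct_repr_tmul_apply, smul_eq_mul, smul_eq_mul, map_mul,
      ← repr_galoisTwist α B hB, ← repr_galoisTwist α B hB, galoisTwist_single, map_one]
  | add x y hx hy => simp only [map_add, Finsupp.add_apply, hx, hy]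
  | smul c x hx => rw [galoisTwist_smul]; simp [hx]

variable [FiniteDimensional K E] [IsGalois K E] [Finite N]

instance : Module.Finite K (fixedAlgebra α) := by
  obtain ⟨n, b, B, hB⟩ := exists_basis_semilinearFixed (galoisTwist_smul α)
  exact Module.Finite.of_basis b

/-- `E[N]` may live in a larger universe than `K`, whereas a Hopf Galois structure needs its Hopf
algebra in the universe of `K`. -/
instance : Small.{u} (fixedAlgebra α) := Module.Finite.small K _

/-- The fixed algebra `E[N]^G` as a Hopf form of `E[N]`. -/
noncomputable def fixedForm :
    HopfForm K E (MonoidAlgebra E N) (Shrink.{u} (fixedAlgebra α)) :=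
  have h := exists_basis_semilinearFixed (galoisTwist_smul α)
  let n := h.choose
  let b : Module.Basis (Fin n) K (fixedAlgebra α) := h.choose_spec.choose
  let B : Module.Basis (Fin n) E (MonoidAlgebra E N) := h.choose_spec.choose_spec.choose
  have hB : ∀ i, B i = b i := h.choose_spec.choose_spec.choose_spec
  let j : Shrink.{u} (fixedAlgebra α) →ₐ[K] MonoidAlgebra E N :=
    (fixedAlgebra α).val.comp (Shrink.algEquiv K (fixedAlgebra α)).toAlgHom
  have hj (a : Shrink.{u} (fixedAlgebra α)) : j a ∈ fixedAlgebra α :=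
    (Shrink.algEquiv K (fixedAlgebra α) a).2
  have hjB (i : Fin n) : B i = j (b.map (Shrink.algEquiv K (fixedAlgebra α)).symm.toLinearEquiv i) := by
    rw [hB]
    simp [j]
  { j := j
    n := n
    b := b.map (Shrink.algEquiv K (fixedAlgebra α)).symm.toLinearEquiv
    B := B
    basis_eq := hjB
    comul_mem := fun a => mem_range_of_repr _ _ _ (mapTensorTower_basis _ _ _ _ hjB _ _ hjB)
      fun i => (IsGalois.mem_range_algebraMap_iff_fixed _).2 fun σ => by
        rw [← repr_comul_galoisTwist α B (fun i => by rw [hB]; exact (b i).2), hj a σ]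
    counit_mem := fun a => (IsGalois.mem_range_algebraMap_iff_fixed _).2 fun σ => by
      rw [← counit_galoisTwist, hj a σ]
    antipode_mem := fun a => by
      refine ⟨(Shrink.algEquiv K (fixedAlgebra α)).symm ⟨HopfAlgebra.antipode E (j a), fun σ => ?_⟩,
        by simp [j]⟩
      rw [← antipode_galoisTwist, hj a σ] }

lemma fixedForm_j_mem (a : Shrink.{u} (fixedAlgebra α)) :
    (fixedForm α).j a ∈ fixedAlgebra α :=
  (Shrink.algEquiv K (fixedAlgebra α) a).2

end TwistedForm

/-! ### From a regular group of permutations to a Hopf Galois structure -/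

section RegularAction

open MonoidAlgebra

variable {K : Type u} {L : Type v} {E : Type w} [Field K] [Field L] [Field E]
  [Algebra K L] [Algebra K E] {N : Type*} [Group N] (π : N →* Equiv.Perm (L →ₐ[K] E))

/-- The action of `E[N]` on embeddings `L → E`, from the right. -/
noncomputable def permTwist (x : L →ₐ[K] E) : MonoidAlgebra E N →ₗ[E] (L →ₗ[K] E) :=
  (MonoidAlgebra.basis N E).constr E fun n => ((π n)⁻¹ x).toLinearMap

lemma permTwist_of (x : L →ₐ[K] E) (n : N) :
    permTwist π x (of E N n) = ((π n)⁻¹ x).toLinearMap := by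
  rw [of_apply, ← MonoidAlgebra.basis_apply, permTwist, Module.Basis.constr_basis]

lemma permTwist_of_mul (x : L →ₐ[K] E) (n : N) (a : MonoidAlgebra E N) :
    permTwist π x (of E N n * a) = permTwist π ((π n)⁻¹ x) a := by
  induction a using MonoidAlgebra.induction_on with
  | of m => rw [← map_mul, permTwist_of, permTwist_of, map_mul, mul_inv_rev]; rfl
  | add x y hx hy => simp only [mul_add, map_add, hx, hy]
  | smul c x hx => simp only [mul_smul_comm, map_smul, hx]

lemma permTwist_one (x : L →ₐ[K] E) : permTwist π x 1 = x.toLinearMap := by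
  rw [← map_one (of E N), permTwist_of, map_one, inv_one, Equiv.Perm.one_apply]

lemma permTwist_apply_mul (x : L →ₐ[K] E) (a : MonoidAlgebra E N) (l m : L) :
    permTwist π x a (l * m) = LinearMap.mul' E E (TensorProduct.map ((permTwist π x).flip l)
      ((permTwist π x).flip m) (Coalgebra.comul a)) := by
  induction a using MonoidAlgebra.induction_on with
  | of n =>
    have h : Coalgebra.comul (R := E) (of E N n) = of E N n ⊗ₜ[E] of E N n := by simp
    rw [h]
    simp only [TensorProduct.map_tmul, LinearMap.mul'_apply, LinearMap.flip_apply, permTwist_of]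
    exact map_mul ((π n)⁻¹ x) l m
  | add x y hx hy => simp only [map_add, LinearMap.add_apply, hx, hy]
  | smul c x hx => simp only [map_smul, LinearMap.smul_apply, hx]

lemma permTwist_apply_one (x : L →ₐ[K] E) (a : MonoidAlgebra E N) :
    permTwist π x a 1 = Coalgebra.counit (R := E) a := by
  induction a using MonoidAlgebra.induction_on with
  | of n => rw [permTwist_of]; simp
  | add x y hx hy => simp only [map_add, LinearMap.add_apply, hx, hy]
  | smul c x hx => simp only [map_smul, LinearMap.smul_apply, hx]

variable {π} {α : (E ≃ₐ[K] E) →* MulAut N}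

lemma permTwist_galois
    (hα : ∀ σ n, π (α σ n) = embeddingPerm K L E σ * π n * (embeddingPerm K L E σ)⁻¹)
    (σ : E ≃ₐ[K] E) (x : L →ₐ[K] E) (a : MonoidAlgebra E N) :
    permTwist π (embeddingPerm K L E σ x) (galoisTwist α σ a) =
      σ.toLinearMap ∘ₗ permTwist π x a := by
  induction a using MonoidAlgebra.induction_on with
  | of n =>
    have h : (π (α σ n))⁻¹ (embeddingPerm K L E σ x) = embeddingPerm K L E σ ((π n)⁻¹ x) := by
      rw [hα]
      simp
    rw [of_apply, galoisTwist_single, map_one, ← of_apply, ← of_apply, permTwist_of, permTwist_of,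
      h]
    rfl
  | add x y hx hy => simp only [map_add, LinearMap.comp_add, hx, hy]
  | smul c x hx =>
    rw [galoisTwist_smul, map_smul, map_smul, hx]
    ext l
    simp

variable [FiniteDimensional K L] [Algebra.IsSeparable K L] [IsNormalClosure K L E]

/-- By regularity the basis `N` of `E[N]` goes bijectively to the basis of embeddings. -/
lemma permTwist_injective (hπ : ∀ x, Function.Bijective fun n => π n x) (x : L →ₐ[K] E) :
    Function.Injective (permTwist π x) := by
  have hb : Function.Bijective (fun n => (π n)⁻¹ x) := by
    have := (hπ x).comp (Equiv.inv N).bijective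
    simpa [Function.comp_def] using this
  have h : permTwist π x = ((MonoidAlgebra.basis N E).equiv (embeddingBasis K L E)
      (Equiv.ofBijective _ hb)).toLinearMap := by
    refine (MonoidAlgebra.basis N E).ext fun n => ?_
    rw [LinearEquiv.coe_coe, Module.Basis.equiv_apply, embeddingBasis_apply,
      MonoidAlgebra.basis_apply, ← of_apply, permTwist_of]
    rfl
  rw [h]
  exact LinearEquiv.injective _

/-- Automorphisms fixing `x(L)` pointwise fix the value, because `a` is invariant; by Galois theory
the value lies in `x(L)`. -/
lemma exists_fixed_preimage
    (hα : ∀ σ n, π (α σ n) = embeddingPerm K L E σ * π n * (embeddingPerm K L E σ)⁻¹)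
    (x : L →ₐ[K] E) {a : MonoidAlgebra E N} (ha : a ∈ fixedAlgebra α) (l : L) :
    permTwist π x a l ∈ LinearMap.range x.toLinearMap := by
  have := isGalois_of_isNormalClosure K L E
  have := finiteDimensional_of_isNormalClosure K L E
  have h : permTwist π x a l ∈ x.fieldRange := by
    rw [← IsGalois.fixedField_fixingSubgroup x.fieldRange]
    rintro ⟨σ, hσ⟩
    have h1 : embeddingPerm K L E σ x = x :=
      AlgHom.ext fun l => (IntermediateField.mem_fixingSubgroup_iff _ _).1 hσ _ ⟨l, rfl⟩
    have h2 := permTwist_galois hα σ x a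
    rw [h1, ha σ] at h2
    exact (LinearMap.congr_fun h2 l).symm
  obtain ⟨m, hm⟩ := h
  exact ⟨m, hm⟩

end RegularAction

section Construction

open MonoidAlgebra

variable {K : Type u} {L : Type v} {E : Type w} [Field K] [Field L] [Field E]
  [Algebra K L] [Algebra K E] {N : Type*} [Group N] {π : N →* Equiv.Perm (L →ₐ[K] E)}
  {α : (E ≃ₐ[K] E) →* MulAut N}
  [FiniteDimensional K L] [Algebra.IsSeparable K L] [IsNormalClosure K L E]
  [FiniteDimensional K E] [IsGalois K E] [Finite N]
  (hπ : ∀ x, Function.Bijective fun n => π n x)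
  (hα : ∀ σ n, π (α σ n) = embeddingPerm K L E σ * π n * (embeddingPerm K L E σ)⁻¹)
  (x : L →ₐ[K] E)

/-- The action of an element of `E[N]^G` on `L`. -/
noncomputable def fixedActionMap (h : Shrink.{u} (fixedAlgebra α)) : Module.End K L :=
  LinearMap.factorThrough x.toLinearMap x.injective (permTwist π x ((fixedForm α).j h))
    (exists_fixed_preimage hα x (fixedForm_j_mem α h))

lemma embedding_fixedActionMap (h : Shrink.{u} (fixedAlgebra α)) (y : L →ₐ[K] E) :
    y.toLinearMap ∘ₗ fixedActionMap hα x h = permTwist π y ((fixedForm α).j h) := by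
  obtain ⟨σ, rfl⟩ := embeddingPerm_transitive K L E x y
  have h1 : x.toLinearMap ∘ₗ fixedActionMap hα x h = permTwist π x ((fixedForm α).j h) :=
    LinearMap.ext fun l => LinearMap.apply_factorThrough x.toLinearMap _ _ _ l
  have h2 := permTwist_galois hα σ x ((fixedForm α).j h)
  rw [fixedForm_j_mem α h σ, ← h1] at h2
  rw [h2]
  rfl

lemma embedding_fixedActionMap_apply (h : Shrink.{u} (fixedAlgebra α)) (y : L →ₐ[K] E) (l : L) :
    y (fixedActionMap hα x h l) = permTwist π y ((fixedForm α).j h) l :=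
  LinearMap.congr_fun (embedding_fixedActionMap hα x h y) l

lemma permTwist_comp_fixedActionMap (a : MonoidAlgebra E N) (h : Shrink.{u} (fixedAlgebra α))
    (y : L →ₐ[K] E) : permTwist π y a ∘ₗ fixedActionMap hα x h =
      permTwist π y (a * (fixedForm α).j h) := by
  induction a using MonoidAlgebra.induction_on with
  | of n => rw [permTwist_of_mul, permTwist_of, embedding_fixedActionMap]
  | add x y hx hy => simp only [add_mul, map_add, LinearMap.add_comp, hx, hy]
  | smul c x hx => simp only [smul_mul_assoc, map_smul, LinearMap.smul_comp, hx]

/-- The action of `E[N]^G` on `L`. -/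
noncomputable def fixedAction : Shrink.{u} (fixedAlgebra α) →ₐ[K] Module.End K L :=
  AlgHom.ofLinearMap
    { toFun := fixedActionMap hα x
      map_add' := fun a b => by
        ext l
        refine x.injective (show x _ = x _ from ?_)
        simp only [LinearMap.add_apply, map_add, embedding_fixedActionMap_apply]
      map_smul' := fun c a => by
        ext l
        refine x.injective (show x _ = x _ from ?_)
        simp only [LinearMap.smul_apply, map_smul, embedding_fixedActionMap_apply,
          RingHom.id_apply]
        rw [← algebraMap_smul E c ((fixedForm α).j a), map_smul, LinearMap.smul_apply,
          algebraMap_smul] }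
    (by
      ext l
      apply x.injective
      refine (embedding_fixedActionMap_apply hα x 1 x l).trans ?_
      rw [map_one, permTwist_one]
      rfl)
    (fun a b => by
      ext l
      apply x.injective
      refine (embedding_fixedActionMap_apply hα x (a * b) x l).trans ?_
      rw [map_mul, ← permTwist_comp_fixedActionMap hα x, ← embedding_fixedActionMap hα x]
      rfl)

lemma embedding_fixedAction_apply (h : Shrink.{u} (fixedAlgebra α)) (y : L →ₐ[K] E) (l : L) :
    y (fixedAction hα x h l) = permTwist π y ((fixedForm α).j h) l :=
  embedding_fixedActionMap_apply hα x h y l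

/-- Compares the Hopf Galois map over `K` with the map `E[N] → Hom_K(L, E)`, whose injectivity is
known. -/
lemma permTwist_baseChangeHom (y : L →ₐ[K] E) (z : L ⊗[K] Shrink.{u} (fixedAlgebra α)) :
    permTwist π y ((fixedForm α).baseChangeHom (y.toLinearMap.rTensor _ z)) =
      y.toLinearMap ∘ₗ TensorProduct.lift ((LinearMap.mul K (Module.End K L)).compl₁₂
        (Algebra.lmul K L).toLinearMap (fixedAction hα x).toLinearMap) z := by
  induction z with
  | zero => simp
  | add x y hx hy => simp only [map_add, LinearMap.comp_add, hx, hy]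
  | tmul l h =>
    ext m
    rw [LinearMap.rTensor_tmul, HopfForm.baseChangeHom_tmul, map_smul, LinearMap.smul_apply,
      ← embedding_fixedAction_apply hα x]
    simp

lemma finrank_fixedForm (hπ : ∀ x, Function.Bijective fun n => π n x) (x : L →ₐ[K] E) :
    Module.finrank K (Shrink.{u} (fixedAlgebra α)) = Module.finrank K L := by
  rw [Module.finrank_eq_nat_card_basis (fixedForm α).b,
    ← Module.finrank_eq_nat_card_basis (fixedForm α).B,
    Module.finrank_eq_nat_card_basis (MonoidAlgebra.basis N E),
    Nat.card_congr (Equiv.ofBijective _ (hπ x)), card_embeddings]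

lemma fixedAction_bijective (hπ : ∀ x, Function.Bijective fun n => π n x) : Function.Bijective (TensorProduct.lift
    ((LinearMap.mul K (Module.End K L)).compl₁₂ (Algebra.lmul K L).toLinearMap
      (fixedAction hα x).toLinearMap)) := by
  have : Module.Finite K (Shrink.{u} (fixedAlgebra α)) := Module.Finite.of_basis (fixedForm α).b
  have hinj : Function.Injective (TensorProduct.lift
    ((LinearMap.mul K (Module.End K L)).compl₁₂ (Algebra.lmul K L).toLinearMap
      (fixedAction hα x).toLinearMap)) := by
    rw [injective_iff_map_eq_zero]
    intro z hz
    have h1 := permTwist_baseChangeHom hα x x z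
    rw [hz, LinearMap.comp_zero] at h1
    have h2 := permTwist_injective hπ x (h1.trans (map_zero _).symm)
    have h3 := (fixedForm α).baseChangeHom_bijective.1 (h2.trans (map_zero _).symm)
    exact Module.Flat.rTensor_preserves_injective_linearMap _ x.injective
      (h3.trans (map_zero _).symm)
  refine ⟨hinj, (LinearMap.injective_iff_surjective_of_finrank_eq_finrank ?_).1 hinj⟩
  rw [Module.finrank_tensorProduct, finrank_fixedForm hπ x, Module.finrank_linearMap]

/-- The Hopf Galois structure defined by a group of permutations of the embeddings that is regular
and normalized by the Galois group. -/
noncomputable def hopfGaloisStructureOfRegular : HopfGaloisStructure K L where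
  H := Shrink.{u} (fixedAlgebra α)
  hopfAlgebra := (fixedForm α).hopfAlgebra
  finite := Module.Finite.of_basis (fixedForm α).b
  cocomm := (fixedForm α).isCocomm
  μ := fixedAction hα x
  map_mul h l m := by
    refine x.injective (show x _ = x _ from ?_)
    rw [embedding_fixedAction_apply, permTwist_apply_mul,
      ← (fixedForm α).tensorSquareMap_comulMap]
    change _ = x (LinearMap.mul' K L (TensorProduct.map _ _ ((fixedForm α).comulMap h)))
    generalize (fixedForm α).comulMap h = z
    induction z with
    | zero => simp
    | add x y hx hy => simp only [map_add, hx, hy]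
    | tmul a b => simp [tensorSquareMap_tmul, embedding_fixedAction_apply]
  map_one h := by
    refine x.injective (show x _ = x _ from ?_)
    rw [embedding_fixedAction_apply, permTwist_apply_one, AlgHom.commutes]
    exact ((fixedForm α).algebraMap_counitMap h).symm
  bijective := fixedAction_bijective hα x hπ

namespace HopfGaloisStructure

/-- The structure defined by a regular group `N` has type `N`. -/
noncomputable def typeEquivOfRegular :
    (E ⊗[K] (hopfGaloisStructureOfRegular hπ hα x).H) ≃ₐc[E] MonoidAlgebra E N :=
  (fixedForm α).baseChangeEquiv

lemma twist_ofRegular (y : L →ₐ[K] E) (w : E ⊗[K] (hopfGaloisStructureOfRegular hπ hα x).H) :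
    (hopfGaloisStructureOfRegular hπ hα x).twist y.toLinearMap w =
      permTwist π y (typeEquivOfRegular hπ hα x w) := by
  induction w with
  | zero => simp
  | add x y hx hy => simp only [map_add, hx, hy]
  | tmul c h =>
    have h1 : typeEquivOfRegular hπ hα x (c ⊗ₜ h) = c • (fixedForm α).j h :=
      (fixedForm α).baseChangeEquiv_tmul c h
    rw [h1, map_smul]
    exact congrArg (c • ·) (embedding_fixedActionMap hα x h y)

lemma mem_permSet_ofRegular {ρ : Equiv.Perm (L →ₐ[K] E)} :
    ρ ∈ (hopfGaloisStructureOfRegular hπ hα x).permSet E ↔ ρ ∈ π.range := by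
  have : Nonempty (L →ₐ[K] E) := ⟨x⟩
  rw [mem_permSet_iff (typeEquivOfRegular hπ hα x)]
  suffices h : permHom (typeEquivOfRegular hπ hα x) = π by rw [h]
  ext1 n
  refine inv_injective (Equiv.ext fun y => AlgHom.toLinearMap_injective ?_)
  rw [permHom_inv_apply, twist_ofRegular, BialgEquiv.apply_symm_apply, permTwist_of]

end HopfGaloisStructure

end Construction

/-! ### The Greither–Pareigis correspondence -/

/-- The regular permutation groups isomorphic to `N` that are normalized by a group `G` acting on
the set `X`. -/
def stableRegular {G X : Type*} [Group G] (θ : G →* Equiv.Perm X) (N : Type*) [Group N] :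
    Set (Subgroup (Equiv.Perm X)) :=
  {R | (∀ x, Function.Bijective fun r : R => (r : Equiv.Perm X) x) ∧
    (∀ g, ∀ r ∈ R, θ g * r * (θ g)⁻¹ ∈ R) ∧ Nonempty (N ≃* R)}

/-- The action on `N` of a group that normalizes its image under an injective homomorphism. -/
noncomputable def conjAction {G N P : Type*} [Group G] [Group N] [Group P] (θ : G →* P) (π : N →* P)
    (hπ : Function.Injective π) (h : ∀ g n, ∃ m, π m = θ g * π n * (θ g)⁻¹) : G →* MulAut N :=
  have key (g : G) (n : N) : π (h g n).choose = θ g * π n * (θ g)⁻¹ := (h g n).choose_spec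
  { toFun := fun g =>
      { toFun := fun n => (h g n).choose
        invFun := fun n => (h g⁻¹ n).choose
        left_inv := fun n => hπ (by rw [key, key, map_inv]; group)
        right_inv := fun n => hπ (by rw [key, key, map_inv]; group)
        map_mul' := fun m n => hπ (by rw [key, map_mul, map_mul, key, key]; group) }
    map_one' := MulEquiv.ext fun n => hπ (by
      refine (key 1 n).trans ?_
      simp)
    map_mul' := fun g g' => MulEquiv.ext fun n => hπ (by
      refine (key (g * g') n).trans (Eq.trans ?_ (key g (h g' n).choose).symm)
      rw [key, map_mul]
      group) }

lemma conjAction_apply {G N P : Type*} [Group G] [Group N] [Group P] (θ : G →* P) (π : N →* P)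
    (hπ : Function.Injective π) (h : ∀ g n, ∃ m, π m = θ g * π n * (θ g)⁻¹) (g : G) (n : N) :
    π (conjAction θ π hπ h g n) = θ g * π n * (θ g)⁻¹ := (h g n).choose_spec

namespace HopfGaloisStructure

variable {K : Type u} {L : Type v} {E : Type w} [Field K] [Field L] [Field E]
  [Algebra K L] [Algebra K E] [FiniteDimensional K L] [Algebra.IsSeparable K L]
  [IsNormalClosure K L E] [Nonempty (L →ₐ[K] E)] {N : Type*} [Group N]

lemma exists_stableRegular_of_hasType {S : HopfGaloisStructure K L} (h : S.HasType E N) :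
    ∃ R ∈ stableRegular (embeddingPerm K L E) N, ∀ ρ, ρ ∈ R ↔ ρ ∈ S.permSet E := by
  obtain ⟨e⟩ := h
  have hinj : Function.Injective (permHom e) := by
    intro m n hmn
    obtain ⟨x⟩ := ‹Nonempty (L →ₐ[K] E)›
    exact permHom_apply_injective e x (Equiv.congr_fun hmn x)
  let ε : N ≃* (permHom e).range := MonoidHom.ofInjective hinj
  refine ⟨(permHom e).range, ⟨fun x => ?_, ?_, ⟨ε⟩⟩, fun ρ => (mem_permSet_iff e).symm⟩
  · have h1 := (permHom_apply_bijective e x).comp ε.symm.bijective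
    convert h1 using 1
    funext r
    obtain ⟨n, rfl⟩ := ε.surjective r
    simp only [Function.comp_apply, MulEquiv.symm_apply_apply]
    rfl
  · rintro σ _ ⟨n, rfl⟩
    obtain ⟨m, hm⟩ := permHom_galois e σ n
    exact ⟨m, hm.symm⟩

lemma exists_hasType_of_stableRegular {R : Subgroup (Equiv.Perm (L →ₐ[K] E))}
    (hR : R ∈ stableRegular (embeddingPerm K L E) N) :
    ∃ S : HopfGaloisStructure K L, S.HasType E N ∧ ∀ ρ, ρ ∈ R ↔ ρ ∈ S.permSet E := by
  obtain ⟨hreg, hnorm, ⟨ε⟩⟩ := hR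
  obtain ⟨x⟩ := ‹Nonempty (L →ₐ[K] E)›
  have := isGalois_of_isNormalClosure K L E
  have := finiteDimensional_of_isNormalClosure K L E
  let π : N →* Equiv.Perm (L →ₐ[K] E) := R.subtype.comp ε.toMonoidHom
  have hinj : Function.Injective π := R.subtype_injective.comp ε.injective
  have hrange : π.range = R := by
    rw [MonoidHom.range_comp, MonoidHom.range_eq_top.2 ε.surjective, ← MonoidHom.range_eq_map,
      Subgroup.range_subtype]
  have hπ (y : L →ₐ[K] E) : Function.Bijective fun n => π n y := (hreg y).comp ε.bijective
  have : Finite N := .of_injective _ (hπ x).1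
  have hmem (σ : E ≃ₐ[K] E) (n : N) :
      ∃ m, π m = embeddingPerm K L E σ * π n * (embeddingPerm K L E σ)⁻¹ := by
    have h1 : embeddingPerm K L E σ * π n * (embeddingPerm K L E σ)⁻¹ ∈ π.range := by
      rw [hrange]
      exact hnorm σ _ (ε n).2
    exact h1
  have hα := conjAction_apply (embeddingPerm K L E) π hinj hmem
  refine ⟨hopfGaloisStructureOfRegular hπ hα x, ⟨typeEquivOfRegular hπ hα x⟩, fun ρ => ?_⟩
  rw [mem_permSet_ofRegular, hrange]

variable (K L E N) in
/-- Greither and Pareigis: Hopf Galois structures of type `N` correspond to regular groups of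
permutations isomorphic to `N` and normalized by the Galois group. -/
theorem exists_hasType_iff : (∃ S : HopfGaloisStructure K L, S.HasType E N) ↔
    (stableRegular (embeddingPerm K L E) N).Nonempty := by
  constructor
  · rintro ⟨S, hS⟩
    obtain ⟨R, hR, -⟩ := exists_stableRegular_of_hasType hS
    exact ⟨R, hR⟩
  · rintro ⟨R, hR⟩
    obtain ⟨S, hS, -⟩ := exists_hasType_of_stableRegular hR
    exact ⟨S, hS⟩

-- `permSet` is a complete isomorphism invariant of structures of a given type, and its values are
-- exactly the stable regular groups.
variable (K L E N) in
theorem numberOfType_eq_ncard :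
    numberOfType K L E N = (stableRegular (embeddingPerm K L E) N).ncard := by
  symm
  choose f hf1 hf2 using fun R (hR : R ∈ stableRegular (embeddingPerm K L E) N) =>
    exists_hasType_of_stableRegular hR
  refine Set.ncard_congr (fun R hR => Quotient.mk (setoid K L) (f R hR))
    (fun R hR => ⟨f R hR, rfl, hf1 R hR⟩) ?_ ?_
  · intro R R' hR hR' h
    have h1 : (f R hR).Iso (f R' hR') := Quotient.exact h
    ext ρ
    rw [hf2 R hR, hf2 R' hR']
    exact ⟨fun h => permSet_subset_of_iso h1 h,
      fun h => permSet_subset_of_iso (iso_equivalence.symm h1) h⟩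
  · rintro _ ⟨S, rfl, hS⟩
    obtain ⟨R, hR, hR2⟩ := exists_stableRegular_of_hasType hS
    refine ⟨R, hR, Quotient.sound ?_⟩
    obtain ⟨e⟩ := hf1 R hR
    refine iso_of_permSet_subset e fun ρ hρ => ?_
    rwa [← hR2, hf2 R hR]

end HopfGaloisStructure

/-! ### Regular cyclic groups as translations, and affine permutations -/

section Charts

variable {n : ℕ} {X : Type*}

/-- The permutation of `X` that corresponds to a translation of `ZMod n`. -/
def translationHom (e : ZMod n ≃ X) : Multiplicative (ZMod n) →* Equiv.Perm X where
  toFun i := e.permCongr (Equiv.addRight i.toAdd)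
  map_one' := by ext; simp
  map_mul' i j := by
    ext
    simp [add_left_comm, add_comm]

/-- The translation of `X` by `i`. -/
abbrev translation (e : ZMod n ≃ X) (i : ZMod n) : Equiv.Perm X :=
  translationHom e (Multiplicative.ofAdd i)

lemma translation_apply (e : ZMod n ≃ X) (i k : ZMod n) : translation e i (e k) = e (k + i) := by
  simp [translation, translationHom]

lemma translation_pow (e : ZMod n ≃ X) (i : ZMod n) (k : ℕ) :
    translation e i ^ k = translation e (k * i) := by
  rw [translation, ← map_pow, ← ofAdd_nsmul, nsmul_eq_mul]

lemma translation_natCast (e : ZMod n ≃ X) (k : ℕ) :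
    translation e (k : ZMod n) = translation e 1 ^ k := by
  rw [translation_pow, mul_one]

lemma perm_ext_chart (e : ZMod n ≃ X) {f g : Equiv.Perm X} (h : ∀ i, f (e i) = g (e i)) :
    f = g := by
  ext x
  obtain ⟨i, rfl⟩ := e.surjective x
  exact h i

lemma mem_range_translationHom {e : ZMod n ≃ X} {f : Equiv.Perm X} :
    f ∈ (translationHom e).range ↔ ∃ i, translation e i = f :=
  ⟨fun ⟨i, hi⟩ => ⟨i.toAdd, hi⟩, fun ⟨_, hi⟩ => ⟨_, hi⟩⟩

lemma translationHom_injective (e : ZMod n ≃ X) : Function.Injective (translationHom e) := by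
  intro i j h
  have := Equiv.congr_fun h (e 0)
  have h2 := (translation_apply e i.toAdd 0).symm.trans (this.trans (translation_apply e j.toAdd 0))
  simpa using e.injective h2

lemma translation_regular (e : ZMod n ≃ X) (x : X) :
    Function.Bijective fun r : (translationHom e).range => (r : Equiv.Perm X) x := by
  obtain ⟨k, rfl⟩ := e.surjective x
  constructor
  · rintro ⟨_, i, rfl⟩ ⟨_, j, rfl⟩ h
    have h2 := (translation_apply e i.toAdd k).symm.trans (h.trans (translation_apply e j.toAdd k))
    have h3 : i = j := by simpa using e.injective h2
    rw [h3]
  · intro y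
    obtain ⟨l, rfl⟩ := e.surjective y
    exact ⟨⟨translation e (l - k), _, rfl⟩, by
      refine (translation_apply e (l - k) k).trans ?_
      rw [add_sub_cancel]⟩

/-- A regular cyclic group of permutations consists of the translations for some identification of
`X` with `ZMod n`. -/
lemma exists_chart {R : Subgroup (Equiv.Perm X)}
    (hreg : ∀ x, Function.Bijective fun r : R => (r : Equiv.Perm X) x)
    (ε : Multiplicative (ZMod n) ≃* R) (x : X) :
    ∃ e : ZMod n ≃ X, e 0 = x ∧ R = (translationHom e).range ∧
      ∀ i, translation e i = ε (Multiplicative.ofAdd i) := by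
  let e : ZMod n ≃ X := Equiv.ofBijective
    (fun i => (ε (Multiplicative.ofAdd i) : Equiv.Perm X) x)
    ((hreg x).comp (ε.bijective.comp Multiplicative.ofAdd.bijective))
  have he (i : ZMod n) : e i = (ε (Multiplicative.ofAdd i) : Equiv.Perm X) x := rfl
  have key (i : ZMod n) : translation e i = ε (Multiplicative.ofAdd i) := by
    refine perm_ext_chart e fun k => ?_
    rw [translation_apply, he, he, add_comm, ofAdd_add, map_mul]
    rfl
  refine ⟨e, by rw [he]; simp, ?_, key⟩
  ext f
  rw [mem_range_translationHom]
  constructor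
  · intro hf
    obtain ⟨i, hi⟩ := ε.surjective ⟨f, hf⟩
    exact ⟨i.toAdd, by rw [key, ofAdd_toAdd, hi]⟩
  · rintro ⟨i, rfl⟩
    rw [key]
    exact (ε _).2

/-- `f` is the affine map `i ↦ u i + b`. -/
def IsAffine (e : ZMod n ≃ X) (f : Equiv.Perm X) (u b : ZMod n) : Prop :=
  ∀ i, f (e i) = e (u * i + b)

lemma IsAffine.mul {e : ZMod n ≃ X} {f g : Equiv.Perm X} {u b u' b' : ZMod n}
    (hf : IsAffine e f u b) (hg : IsAffine e g u' b') :
    IsAffine e (f * g) (u * u') (u * b' + b) := fun i => by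
  rw [Equiv.Perm.mul_apply, hg, hf]
  congr 1
  ring

lemma IsAffine.eq {e : ZMod n ≃ X} {f g : Equiv.Perm X} {u b : ZMod n}
    (hf : IsAffine e f u b) (hg : IsAffine e g u b) : f = g :=
  perm_ext_chart e fun i => (hf i).trans (hg i).symm

lemma IsAffine.coeff_eq {e : ZMod n ≃ X} {f : Equiv.Perm X} {u b u' b' : ZMod n}
    (hf : IsAffine e f u b) (hg : IsAffine e f u' b') : u = u' ∧ b = b' := by
  have h0 : b = b' := by simpa using e.injective ((hf 0).symm.trans (hg 0))
  have h1 : u + b = u' + b' := by simpa using e.injective ((hf 1).symm.trans (hg 1))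
  exact ⟨by rw [h0] at h1; exact add_right_cancel h1, h0⟩

lemma isAffine_translation (e : ZMod n ≃ X) (i : ZMod n) : IsAffine e (translation e i) 1 i :=
  fun k => by rw [translation_apply, one_mul]

lemma isAffine_one (e : ZMod n ≃ X) : IsAffine e 1 1 0 := fun k => by simp

lemma IsAffine.isUnit {e : ZMod n ≃ X} {f : Equiv.Perm X} {u b : ZMod n} (hf : IsAffine e f u b) :
    IsUnit u := by
  obtain ⟨x, hx⟩ := f.surjective (e (1 + b))
  obtain ⟨i, rfl⟩ := e.surjective x
  rw [hf i] at hx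
  exact IsUnit.of_mul_eq_one i (add_right_cancel (e.injective hx))

lemma IsAffine.conj_translation {e : ZMod n ≃ X} {f : Equiv.Perm X} {u b : ZMod n}
    (hf : IsAffine e f u b) (i : ZMod n) : f * translation e i * f⁻¹ = translation e (u * i) := by
  rw [mul_inv_eq_iff_eq_mul]
  refine (hf.mul (isAffine_translation e i)).eq ?_
  have := (isAffine_translation e (u * i)).mul hf
  convert this using 1 <;> ring

/-- A permutation that normalizes the translations is affine. -/
lemma exists_isAffine [NeZero n] {e : ZMod n ≃ X} {f : Equiv.Perm X}
    (h : ∀ r ∈ (translationHom e).range, f * r * f⁻¹ ∈ (translationHom e).range) :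
    ∃ u b, IsAffine e f u b := by
  obtain ⟨u, hu⟩ := mem_range_translationHom.1 (h (translation e 1) ⟨_, rfl⟩)
  refine ⟨u, e.symm (f (e 0)), fun i => ?_⟩
  have h1 : f * translation e i * f⁻¹ = translation e (u * i) := by
    conv_lhs => rw [← ZMod.natCast_zmod_val i, translation_natCast, ← conj_pow, ← hu,
      translation_pow, ZMod.natCast_zmod_val, mul_comm]
  have h2 : f * translation e i = translation e (u * i) * f := mul_inv_eq_iff_eq_mul.1 h1
  have h3 := Equiv.congr_fun h2 (e 0)
  rw [Equiv.Perm.mul_apply, Equiv.Perm.mul_apply, translation_apply, zero_add] at h3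
  rw [h3]
  conv_lhs => rw [← e.apply_symm_apply (f (e 0))]
  rw [translation_apply, add_comm]

/-- The sum `1 + u + ⋯ + u ^ (k - 1)`. -/
def geomSum (u : ZMod n) (k : ℕ) : ZMod n := ∑ i ∈ Finset.range k, u ^ i

lemma geomSum_succ (u : ZMod n) (k : ℕ) : geomSum u (k + 1) = u * geomSum u k + 1 := by
  rw [geomSum, geom_sum_succ]
  rfl

lemma geomSum_zero (u : ZMod n) : geomSum u 0 = 0 := by simp [geomSum]

lemma geomSum_add (u : ZMod n) (k l : ℕ) :
    geomSum u (k + l) = geomSum u k + u ^ k * geomSum u l := by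
  simp only [geomSum, Finset.sum_range_add, pow_add, Finset.mul_sum]

lemma geomSum_mul (u : ZMod n) (k l : ℕ) :
    geomSum u (k * l) = geomSum u k * geomSum (u ^ k) l := by
  induction l with
  | zero => simp [geomSum_zero]
  | succ l ih => rw [mul_add, mul_one, add_comm, geomSum_add, ih, geomSum_succ]; ring

lemma geomSum_mul_sub_one (u : ZMod n) (k : ℕ) : geomSum u k * (u - 1) = u ^ k - 1 :=
  geom_sum_mul u k

lemma IsAffine.pow {e : ZMod n ≃ X} {f : Equiv.Perm X} {u b : ZMod n} (hf : IsAffine e f u b)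
    (k : ℕ) : IsAffine e (f ^ k) (u ^ k) (b * geomSum u k) := by
  induction k with
  | zero => simpa [geomSum_zero] using isAffine_one e
  | succ k ih =>
    have := hf.mul ih
    rw [pow_succ', pow_succ', geomSum_succ]
    convert this using 1
    ring

/-- `i ↦ u i + 1` is an `n`-cycle. -/
def IsCycleMultiplier (u : ZMod n) : Prop := ∀ k : ℕ, geomSum u k = 0 ↔ n ∣ k

lemma IsCycleMultiplier.geomSum_add_mul {u : ZMod n} (hu : IsCycleMultiplier u) (k l : ℕ) :
    geomSum u (k + n * l) = geomSum u k := by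
  rw [geomSum_add, (hu (n * l)).2 (dvd_mul_right _ _), mul_zero, add_zero]

lemma IsCycleMultiplier.geomSum_mod {u : ZMod n} (hu : IsCycleMultiplier u) (k : ℕ) :
    geomSum u (k % n) = geomSum u k := by
  conv_rhs => rw [← Nat.mod_add_div k n, hu.geomSum_add_mul]

lemma IsCycleMultiplier.geomSum_val {u : ZMod n} (hu : IsCycleMultiplier u) (k : ℕ) :
    geomSum u (k : ZMod n).val = geomSum u k := by
  rw [ZMod.val_natCast, hu.geomSum_mod]

lemma IsCycleMultiplier.bijective [NeZero n] {u : ZMod n} (hu : IsCycleMultiplier u) (hu' : IsUnit u) :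
    Function.Bijective fun k : ZMod n => geomSum u k.val := by
  refine (Finite.injective_iff_bijective).1 ?_
  have key (i j : ZMod n) (hij : i.val ≤ j.val) (h : geomSum u i.val = geomSum u j.val) :
      i = j := by
    obtain ⟨l, hl⟩ := Nat.exists_eq_add_of_le hij
    rw [hl, geomSum_add] at h
    have h2 : u ^ i.val * geomSum u l = 0 := by simpa using h.symm
    have h3 : n ∣ l := (hu l).1 ((hu'.pow _).mul_right_eq_zero.1 h2)
    have h4 := ZMod.val_lt j
    have h5 : l = 0 := Nat.eq_zero_of_dvd_of_lt h3 (by omega)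
    exact ZMod.val_injective n (by omega)
  intro i j h
  rcases le_total i.val j.val with h1 | h1
  · exact key i j h1 h
  · exact (key j i h1 h.symm).symm

end Charts

/-! ### Stable regular cyclic groups parametrized by multipliers -/

section Parametrization

variable {n : ℕ} {X : Type*} {c e e' : ZMod n ≃ X} {u u' : ZMod n}

/-- Both sides are the `k`-th iterate of the same permutation at the base point. Thus `u` determines
the chart `e` from `c`. -/
lemma chart_geomSum (h0 : e 0 = c 0) (h : IsAffine e (translation c 1) u 1) (k : ℕ) :
    e (geomSum u k) = c k := by
  have h1 := h.pow k 0
  rw [h0, mul_zero, zero_add, one_mul, ← translation_natCast, translation_apply, zero_add] at h1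
  exact h1.symm

lemma isCycleMultiplier_of_chart (h0 : e 0 = c 0) (h : IsAffine e (translation c 1) u 1) :
    IsCycleMultiplier u := fun k => by
  rw [← e.injective.eq_iff, chart_geomSum h0 h, h0, c.injective.eq_iff, ZMod.natCast_eq_zero_iff]

lemma chart_ext [NeZero n] (h0 : e 0 = e' 0) (h : translation e 1 = translation e' 1) : e = e' := by
  ext i
  have h1 := translation_apply e i 0
  have h2 := translation_apply e' i 0
  rw [← ZMod.natCast_zmod_val i, translation_natCast, ZMod.natCast_zmod_val, zero_add] at h1 h2
  rw [← h1, ← h2, h, h0]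

/-- Charts with the same translations and the same origin differ by a scalar, and `f (e 0) = e 1`
fixes that scalar. -/
lemma multiplier_unique [NeZero n] (h0 : e 0 = e' 0)
    (hR : (translationHom e).range = (translationHom e').range) {f : Equiv.Perm X}
    (h : IsAffine e f u 1) (h' : IsAffine e' f u' 1) : u = u' := by
  have h1 : e 1 = e' 1 := by
    have a := h 0
    have a' := h' 0
    rw [mul_zero, zero_add] at a a'
    rw [← a, ← a', h0]
  have h2 : translation e' 1 ∈ (translationHom e).range := by rw [hR]; exact ⟨_, rfl⟩
  obtain ⟨m, hm⟩ := mem_range_translationHom.1 h2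
  have h3 := translation_apply e' 1 0
  rw [← hm, ← h0, translation_apply, zero_add, zero_add, ← h1] at h3
  rw [e.injective h3] at hm
  obtain rfl := chart_ext h0 hm
  exact (h.coeff_eq h').1

lemma chart_unique [NeZero n] (h0 : e 0 = c 0) (h : IsAffine e (translation c 1) u 1)
    (h0' : e' 0 = c 0) (h' : IsAffine e' (translation c 1) u 1) : e = e' := by
  ext i
  obtain ⟨k, rfl⟩ := ((isCycleMultiplier_of_chart h0 h).bijective h.isUnit).2 i
  exact (chart_geomSum h0 h k.val).trans (chart_geomSum h0' h' k.val).symm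

lemma exists_multiplierChart [NeZero n] (hu : IsUnit u) (hu' : IsCycleMultiplier u)
    (c : ZMod n ≃ X) :
    ∃ e : ZMod n ≃ X, e 0 = c 0 ∧ IsAffine e (translation c 1) u 1 := by
  let f : ZMod n ≃ ZMod n := Equiv.ofBijective _ (hu'.bijective hu)
  have hf (k : ZMod n) : f k = geomSum u k.val := rfl
  let e : ZMod n ≃ X := f.symm.trans c
  have he (k : ℕ) : e (geomSum u k) = c k := by
    rw [← hu'.geomSum_val, ← hf]
    simp [e]
  refine ⟨e, ?_, fun i => ?_⟩
  · have := he 0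
    rwa [geomSum_zero, Nat.cast_zero] at this
  · obtain ⟨k, rfl⟩ := f.surjective i
    rw [hf, he, translation_apply, ← geomSum_succ, he, Nat.cast_succ]

lemma exists_chart_affine_one {e : ZMod n ≃ X} {b : ZMod n} (h0 : e 0 = c 0)
    (h : IsAffine e (translation c 1) u b) [NeZero n] :
    ∃ e' : ZMod n ≃ X, e' 0 = c 0 ∧ (translationHom e').range = (translationHom e).range ∧
      IsAffine e' (translation c 1) u 1 := by
  -- Powers of the `n`-cycle `translation c 1` move the origin to `e 1`, so `1` is a multiple of
  -- `b`.
  have hb : IsUnit b := by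
    obtain ⟨k, hk⟩ := c.surjective (e 1)
    have h1 := h.pow k.val 0
    rw [h0, mul_zero, zero_add, ← translation_natCast, translation_apply, zero_add,
      ZMod.natCast_zmod_val, hk] at h1
    exact IsUnit.of_mul_eq_one _ (e.injective h1).symm
  obtain ⟨b, rfl⟩ := hb
  let e' : ZMod n ≃ X := (Units.mulLeft b).trans e
  have he' (i : ZMod n) : e' i = e (b * i) := rfl
  have ht (i : ZMod n) : translation e' i = translation e (b * i) :=
    perm_ext_chart e' fun k => by
      rw [translation_apply, he', he', translation_apply, mul_add]
  refine ⟨e', by rw [he', mul_zero, h0], ?_, fun i => ?_⟩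
  · ext f
    rw [mem_range_translationHom, mem_range_translationHom]
    constructor
    · rintro ⟨i, rfl⟩
      exact ⟨_, (ht i).symm⟩
    · rintro ⟨i, rfl⟩
      exact ⟨((b⁻¹ : (ZMod n)ˣ) : ZMod n) * i, by rw [ht, Units.mul_inv_cancel_left]⟩
  · rw [he', h, he']
    congr 1
    ring

/-- Write `t = translation c 1`. Then `f * t * f⁻¹ = t ^ v`; in the chart `e`, conjugation does not
change linear parts, so `u = u ^ v`. -/
lemma pow_val_eq_self [NeZero n] (h0 : e 0 = c 0) (h : IsAffine e (translation c 1) u 1)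
    {f : Equiv.Perm X} {v a b : ZMod n} (hf : IsAffine c f v 0) (hf' : IsAffine e f a b) :
    u ^ v.val = u := by
  obtain rfl : b = 0 := by
    have h1 := hf 0
    rw [← h0, hf', mul_zero, zero_add, mul_zero, zero_add, ← h0] at h1
    exact e.injective h1
  have h1 := mul_inv_eq_iff_eq_mul.1 (hf.conj_translation 1)
  rw [mul_one, ← ZMod.natCast_zmod_val v, translation_natCast] at h1
  have h2 := hf'.mul h
  rw [h1] at h2
  have h3 := (h.pow v.val).mul hf'
  have h4 := (h3.coeff_eq h2).1
  rw [mul_comm] at h4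
  exact hf'.isUnit.mul_left_cancel h4

/-- In the chart `e`, `f` sends `geomSum u k` to `geomSum u (v * k)`, which factors as `geomSum u v
* geomSum (u ^ v) k`; the last factor is `geomSum u k` again. -/
lemma isAffine_of_pow_val_eq_self [NeZero n] (h0 : e 0 = c 0)
    (h : IsAffine e (translation c 1) u 1) {f : Equiv.Perm X} {v : ZMod n} (hf : IsAffine c f v 0)
    (hv : u ^ v.val = u) : IsAffine e f (geomSum u v.val) 0 := fun i => by
  obtain ⟨k, rfl⟩ := ((isCycleMultiplier_of_chart h0 h).bijective h.isUnit).2 i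
  have h1 : geomSum u v.val * geomSum u k.val = geomSum u (v.val * k.val) := by
    rw [geomSum_mul, hv]
  simp only
  rw [add_zero, h1, chart_geomSum h0 h, chart_geomSum h0 h, hf]
  simp

variable {G : Type*} [Group G] (θ : G →* Equiv.Perm X)

/-- The parameters of the regular cyclic groups that are normalized by `G`. -/
def stableMultipliers (c : ZMod n ≃ X) : Set (ZMod n) :=
  {u | IsUnit u ∧ IsCycleMultiplier u ∧ ∀ g v, IsAffine c (θ g) v 0 → u ^ v.val = u}

variable {θ} in
lemma exists_multiplier [NeZero n] (ht : ∃ g, θ g = translation c 1) {R : Subgroup (Equiv.Perm X)}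
    (hR : R ∈ stableRegular θ (Multiplicative (ZMod n))) :
    ∃ u ∈ stableMultipliers θ c, ∃ e : ZMod n ≃ X, R = (translationHom e).range ∧ e 0 = c 0 ∧
      IsAffine e (translation c 1) u 1 := by
  obtain ⟨hreg, hnorm, ⟨ε⟩⟩ := hR
  obtain ⟨e₀, h0, rfl, -⟩ := exists_chart hreg ε (c 0)
  obtain ⟨t, ht⟩ := ht
  obtain ⟨u, b, hub⟩ := exists_isAffine (hnorm t)
  rw [ht] at hub
  obtain ⟨e, he0, hrange, he⟩ := exists_chart_affine_one h0 hub
  refine ⟨u, ⟨he.isUnit, isCycleMultiplier_of_chart he0 he, fun g v hv => ?_⟩, e, hrange.symm, he0,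
    he⟩
  have hg := hnorm g
  rw [← hrange] at hg
  obtain ⟨a, b', hab⟩ := exists_isAffine hg
  exact pow_val_eq_self he0 he hv hab

variable {θ} in
lemma exists_stableRegular_of_multiplier [NeZero n] (hc : ∀ g, ∃ v b, IsAffine c (θ g) v b)
    (ht : ∃ g, θ g = translation c 1) (hu : u ∈ stableMultipliers θ c) :
    ∃ R ∈ stableRegular θ (Multiplicative (ZMod n)), ∃ e : ZMod n ≃ X,
      R = (translationHom e).range ∧ e 0 = c 0 ∧ IsAffine e (translation c 1) u 1 := by
  obtain ⟨h1, h2, h3⟩ := hu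
  obtain ⟨e, h0, he⟩ := exists_multiplierChart h1 h2 c
  refine ⟨_, ⟨translation_regular e, fun g => ?_,
    ⟨MonoidHom.ofInjective (translationHom_injective e)⟩⟩, e, rfl, h0, he⟩
  obtain ⟨v, b, hg⟩ := hc g
  obtain ⟨t, ht⟩ := ht
  -- A translation, which already is affine in the chart `e`, corrects `θ g` so that it fixes the
  -- origin.
  have hk : IsAffine c (θ ((t ^ b.val)⁻¹ * g)) v 0 := fun i => by
    rw [map_mul, map_inv, map_pow, ht, ← translation_natCast, ZMod.natCast_zmod_val,
      Equiv.Perm.mul_apply, hg, Equiv.Perm.inv_eq_iff_eq, add_zero, translation_apply]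
  have h4 := isAffine_of_pow_val_eq_self h0 he hk (h3 _ _ hk)
  have h5 := (he.pow b.val).mul h4
  rw [← ht, ← map_pow, ← map_mul, mul_inv_cancel_left] at h5
  intro r hr
  obtain ⟨i, rfl⟩ := mem_range_translationHom.1 hr
  rw [h5.conj_translation]
  exact ⟨_, rfl⟩

/-- The regular cyclic groups normalized by `G` correspond to their multipliers. -/
theorem ncard_stableRegular [NeZero n] (hc : ∀ g, ∃ v b, IsAffine c (θ g) v b)
    (ht : ∃ g, θ g = translation c 1) :
    (stableRegular θ (Multiplicative (ZMod n))).ncard = (stableMultipliers θ c).ncard := by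
  choose f hf1 e he1 he2 he3 using fun R
    (hR : R ∈ stableRegular θ (Multiplicative (ZMod n))) => exists_multiplier ht hR
  refine Set.ncard_congr f hf1 ?_ ?_
  · intro R R' hR hR' h
    have h3 := he3 R hR
    rw [h] at h3
    rw [he1 R hR, he1 R' hR', chart_unique (he2 R hR) h3 (he2 R' hR') (he3 R' hR')]
  · intro u hu
    obtain ⟨R, hR, e', h1, h2, h3⟩ := exists_stableRegular_of_multiplier hc ht hu
    refine ⟨R, hR, multiplier_unique ((he2 R hR).trans h2.symm) ?_ (he3 R hR) h3⟩
    rw [← he1 R hR, ← h1]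

end Parametrization

/-! ### Arithmetic modulo the cube of an odd prime -/

section PrimeCube

variable {p : ℕ}

lemma pow_dvd_intCast_iff {j : ℕ} (hj : j ≤ 3) (z : ℤ) :
    (p : ZMod (p ^ 3)) ^ j ∣ (z : ZMod (p ^ 3)) ↔ (p : ℤ) ^ j ∣ z := by
  constructor
  · rintro ⟨y, hy⟩
    obtain ⟨w, rfl⟩ := ZMod.intCast_surjective y
    have h : ((z - (p : ℤ) ^ j * w : ℤ) : ZMod (p ^ 3)) = 0 := by
      push_cast
      rw [hy, sub_self]
    rw [ZMod.intCast_zmod_eq_zero_iff_dvd, Nat.cast_pow] at h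
    exact (dvd_sub_left (dvd_mul_right _ _)).1 ((pow_dvd_pow _ hj).trans h)
  · rintro ⟨w, rfl⟩
    exact ⟨w, by push_cast; rfl⟩

lemma prime_cube_dvd_pow_sub_one_iff (hp : p.Prime) (hp2 : Odd p) {a : ℤ} (ha : (p : ℤ) ∣ a - 1)
    {i : ℕ} (hi : i ≤ 3) : (p : ℤ) ^ 3 ∣ a ^ p ^ i - 1 ↔ (p : ℤ) ^ (3 - i) ∣ a - 1 := by
  have hpa : ¬ (p : ℤ) ∣ a := fun h => by
    have h1 := (dvd_sub_right h).1 ha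
    exact (Nat.prime_iff_prime_int.1 hp).not_dvd_one h1
  have h := Int.emultiplicity_pow_sub_pow hp hp2 ha hpa (p ^ i)
  rw [one_pow, emultiplicity_pow_self hp.ne_zero hp.prime.not_isUnit] at h
  obtain ⟨j, hj⟩ := Nat.exists_eq_add_of_le' hi
  rw [pow_dvd_iff_le_emultiplicity, pow_dvd_iff_le_emultiplicity, h, hj, Nat.add_sub_cancel,
    Nat.cast_add, ENat.add_le_add_iff_right (ENat.natCast_ne_top i)]

/-- Lifting the exponent: `a ^ k - 1` has valuation `v(a - 1) + v(k)`, so the sum has valuation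
`v(k)`. Cancelling requires `v(a - 1)` finite, hence `a ≠ 1`. -/
lemma prime_cube_dvd_geom_sum_iff (hp : p.Prime) (hp2 : Odd p) {a : ℤ} (ha : (p : ℤ) ∣ a - 1)
    (ha1 : a ≠ 1) (k : ℕ) : (p : ℤ) ^ 3 ∣ ∑ i ∈ Finset.range k, a ^ i ↔ p ^ 3 ∣ k := by
  have hp' := Nat.prime_iff_prime_int.1 hp
  have hpa : ¬ (p : ℤ) ∣ a := fun h => hp'.not_dvd_one ((dvd_sub_right h).1 ha)
  have h := Int.emultiplicity_pow_sub_pow hp hp2 ha hpa k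
  have hf : FiniteMultiplicity (p : ℤ) (a - 1) :=
    Int.finiteMultiplicity_iff.2 ⟨by simpa using hp.ne_one, sub_ne_zero.2 ha1⟩
  rw [one_pow, ← geom_sum_mul, emultiplicity_mul hp', add_comm,
    (ENat.add_right_injective_of_ne_top (finiteMultiplicity_iff_emultiplicity_ne_top.1 hf)).eq_iff] at h
  rw [pow_dvd_iff_le_emultiplicity, pow_dvd_iff_le_emultiplicity, h]

lemma dvd_sub_one_of_pow_eq_one (hp : p.Prime) {u : ZMod (p ^ 3)} {i : ℕ} (h : u ^ p ^ i = 1) :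
    (p : ZMod (p ^ 3)) ∣ u - 1 := by
  have := Fact.mk hp
  obtain ⟨a, rfl⟩ := ZMod.intCast_surjective u
  have h1 : (((a ^ p ^ i - 1 : ℤ)) : ZMod (p ^ 3)) = 0 := by
    push_cast
    rw [h, sub_self]
  rw [ZMod.intCast_zmod_eq_zero_iff_dvd, Nat.cast_pow] at h1
  have h2 : (((a ^ p ^ i - 1 : ℤ)) : ZMod p) = 0 :=
    (ZMod.intCast_zmod_eq_zero_iff_dvd _ _).2 ((dvd_pow_self _ three_ne_zero).trans h1)
  push_cast at h2
  rw [ZMod.pow_card_pow] at h2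
  have h3 : ((a - 1 : ℤ) : ZMod p) = 0 := by push_cast; exact h2
  rw [ZMod.intCast_zmod_eq_zero_iff_dvd] at h3
  have h4 := (pow_dvd_intCast_iff (p := p) (j := 1) (by norm_num) (a - 1)).2 (by rwa [pow_one])
  simpa using h4

/-- In `ZMod (p ^ 3)`, for `i ≤ 3`, the elements `u ≡ 1` modulo `p` with `u ^ p ^ i = 1` are those
with `u ≡ 1` modulo `p ^ (3 - i)`. -/
lemma pow_prime_pow_eq_one_iff (hp : p.Prime) (hp2 : Odd p) {i : ℕ} (hi : i ≤ 2)
    (u : ZMod (p ^ 3)) : u ^ p ^ i = 1 ↔ (p : ZMod (p ^ 3)) ^ (3 - i) ∣ u - 1 := by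
  have key (h : (p : ZMod (p ^ 3)) ∣ u - 1) :
      u ^ p ^ i = 1 ↔ (p : ZMod (p ^ 3)) ^ (3 - i) ∣ u - 1 := by
    obtain ⟨a, rfl⟩ := ZMod.intCast_surjective u
    have h4 : (p : ℤ) ∣ a - 1 := by
      have := (pow_dvd_intCast_iff (p := p) (j := 1) (by norm_num) (a - 1)).1
        (by rw [pow_one]; push_cast; exact h)
      rwa [pow_one] at this
    have h5 := prime_cube_dvd_pow_sub_one_iff hp hp2 h4 (i := i) (by omega)
    rw [← pow_dvd_intCast_iff (j := 3 - i) (by omega), ← Nat.cast_pow,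
      ← ZMod.intCast_zmod_eq_zero_iff_dvd] at h5
    push_cast at h5
    rw [← h5, sub_eq_zero]
  refine ⟨fun h => (key (dvd_sub_one_of_pow_eq_one hp h)).1 h, fun h => (key ?_).2 h⟩
  exact (dvd_pow_self _ (by omega)).trans h

lemma isUnit_of_not_prime_dvd (hp : p.Prime) {x : ZMod (p ^ 3)}
    (h : ¬ (p : ZMod (p ^ 3)) ∣ x) : IsUnit x := by
  have : NeZero (p ^ 3) := ⟨pow_ne_zero _ hp.ne_zero⟩
  rw [← ZMod.natCast_zmod_val x, ZMod.isUnit_iff_coprime]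
  refine (Nat.Coprime.pow_right 3 ?_)
  rw [Nat.coprime_comm, hp.coprime_iff_not_dvd]
  rintro ⟨y, hy⟩
  refine h ⟨y, ?_⟩
  rw [← ZMod.natCast_zmod_val x, hy, Nat.cast_mul]

lemma isCycleMultiplier_iff (hp : p.Prime) (hp2 : Odd p) {u : ZMod (p ^ 3)} (hu : IsUnit u) :
    IsCycleMultiplier u ↔ u ^ p ^ 2 = 1 := by
  have : NeZero (p ^ 3) := ⟨pow_ne_zero _ hp.ne_zero⟩
  constructor
  · intro h
    rw [pow_prime_pow_eq_one_iff hp hp2 le_rfl, show 3 - 2 = 1 from rfl, pow_one]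
    -- If `u - 1` were a unit, `u ^ φ(p ^ 3) = 1` would make the geometric sum vanish at the
    -- totient, which is positive and below `p ^ 3`.
    by_contra hd
    have h1 := geomSum_mul_sub_one u (p ^ 3).totient
    have h2 : u ^ (p ^ 3).totient = 1 := by
      obtain ⟨u, rfl⟩ := hu
      rw [← Units.val_pow_eq_pow_val, ZMod.pow_totient, Units.val_one]
    rw [h2, sub_self, (isUnit_of_not_prime_dvd hp hd).mul_left_eq_zero, h] at h1
    have h3 := Nat.le_of_dvd (Nat.totient_pos.2 (pow_pos hp.pos _)) h1
    have h4 := Nat.totient_lt (p ^ 3) (Nat.one_lt_pow (by norm_num) hp.one_lt)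
    omega
  · intro h k
    have h1 := dvd_sub_one_of_pow_eq_one hp h
    -- The shift by `p ^ 3` keeps the integer lift different from `1` even when `u = 1`.
    let a : ℤ := u.val + p ^ 3
    have ha : (a : ZMod (p ^ 3)) = u := by
      have : ((p : ZMod (p ^ 3))) ^ 3 = 0 := by
        rw [← Nat.cast_pow, ZMod.natCast_self]
      simp [a, this]
    have ha1 : a ≠ 1 := by
      have h5 := Nat.one_lt_pow (n := 3) (by norm_num) hp.one_lt
      have h6 : (1 : ℤ) < (p : ℤ) ^ 3 := by exact_mod_cast h5
      simp only [a]
      omega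
    have h4 : (p : ℤ) ∣ a - 1 := by
      have := (pow_dvd_intCast_iff (p := p) (j := 1) (by norm_num) (a - 1)).1
        (by rw [pow_one]; push_cast; rw [ha]; exact h1)
      rwa [pow_one] at this
    rw [← prime_cube_dvd_geom_sum_iff hp hp2 h4 ha1, ← Nat.cast_pow,
      ← ZMod.intCast_zmod_eq_zero_iff_dvd]
    push_cast
    rw [ha]
    rfl

lemma card_units_prime_cube (hp : p.Prime) : Nat.card (ZMod (p ^ 3))ˣ = p ^ 2 * (p - 1) := by
  have : NeZero (p ^ 3) := ⟨pow_ne_zero _ hp.ne_zero⟩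
  rw [Nat.card_eq_fintype_card, ZMod.card_units_eq_totient, Nat.totient_prime_pow hp (by norm_num)]

/-- The units modulo `p ^ 3` form a cyclic group of order `p ^ 2 * (p - 1)`, since `p` is odd. -/
lemma ncard_pow_eq_one (hp : p.Prime) (hp2 : Odd p) {m : ℕ} (hm : m ∣ p ^ 2 * (p - 1)) :
    {u : ZMod (p ^ 3) | u ^ m = 1}.ncard = m := by
  have : NeZero (p ^ 3) := ⟨pow_ne_zero _ hp.ne_zero⟩
  have hcyc := ZMod.isCyclic_units_of_prime_pow p hp (by rintro rfl; exact absurd hp2 (by decide)) 3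
  have hm0 : m ≠ 0 := by
    rintro rfl
    have := hp.two_le
    have h0 := zero_dvd_iff.1 hm
    rcases mul_eq_zero.1 h0 with h | h
    · exact pow_ne_zero _ hp.ne_zero h
    · omega
  have h := IsCyclic.card_powMonoidHom_ker (ZMod (p ^ 3))ˣ m
  rw [card_units_prime_cube hp, Nat.gcd_eq_right hm] at h
  refine Eq.trans ?_ h
  rw [← SetLike.coe_sort_coe, Nat.card_coe_set_eq, ← Set.ncard_image_of_injective _ Units.val_injective]
  congr 1
  ext u
  constructor
  · intro hu
    obtain ⟨u, rfl⟩ := IsUnit.of_pow_eq_one (a := u) hu hm0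
    refine ⟨u, ?_, rfl⟩
    exact Units.val_injective (by simpa using hu)
  · rintro ⟨u, hu, rfl⟩
    have : u ^ m = 1 := hu
    rw [Set.mem_ofPred_eq, ← Units.val_pow_eq_pow_val, this, Units.val_one]

end PrimeCube

/-! ### Counting multipliers -/

section PrimeCubeCount

variable {p : ℕ}

lemma pow_val_eq_self_iff (hp : p.Prime) {u v : ZMod (p ^ 3)} {j : ℕ} (hj : j ≤ 3)
    (hu : orderOf u = p ^ j) : u ^ v.val = u ↔ (p : ZMod (p ^ 3)) ^ j ∣ v - 1 := by
  have : NeZero (p ^ 3) := ⟨pow_ne_zero _ hp.ne_zero⟩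
  have h0 : p ^ j ≠ 0 := pow_ne_zero _ hp.ne_zero
  obtain ⟨u, rfl⟩ := IsUnit.of_pow_eq_one (hu ▸ pow_orderOf_eq_one u) h0
  rw [orderOf_units] at hu
  have h1 : v - 1 = ((v.val - 1 : ℤ) : ZMod (p ^ 3)) := by simp
  rw [h1, pow_dvd_intCast_iff hj, ← Units.val_pow_eq_pow_val, Units.val_inj]
  conv_lhs => rw [← pow_one u, ← pow_mul, one_mul]
  rw [pow_inj_mod, ← Nat.ModEq, Nat.ModEq.comm, Nat.modEq_iff_dvd, hu]
  push_cast
  rfl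

variable {X G : Type*} [Group G] (θ : G →* Equiv.Perm X) (c : ZMod (p ^ 3) ≃ X)

lemma mem_stableMultipliers_iff (hp : p.Prime) (hp2 : Odd p) {u : ZMod (p ^ 3)} :
    u ∈ stableMultipliers θ c ↔
      u ^ p ^ 2 = 1 ∧ ∀ g v, IsAffine c (θ g) v 0 → u ^ v.val = u := by
  constructor
  · rintro ⟨h1, h2, h3⟩
    exact ⟨(isCycleMultiplier_iff hp hp2 h1).1 h2, h3⟩
  · rintro ⟨h1, h2⟩
    have h3 : IsUnit u := IsUnit.of_pow_eq_one h1 (pow_ne_zero _ hp.ne_zero)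
    exact ⟨h3, (isCycleMultiplier_iff hp hp2 h3).2 h1, h2⟩

/-- Every `v` is `1` modulo `p ^ 2`, a multiple of the order of each candidate `u`, so the
stabilizer imposes no condition. -/
lemma ncard_stableMultipliers_of_pow_eq_one (hp : p.Prime) (hp2 : Odd p)
    (h : ∀ g v, IsAffine c (θ g) v 0 → v ^ p = 1) :
    (stableMultipliers θ c).ncard = p ^ 2 := by
  rw [← ncard_pow_eq_one hp hp2 (m := p ^ 2) (dvd_mul_right _ _)]
  congr 1
  ext u
  rw [mem_stableMultipliers_iff θ c hp hp2, Set.mem_ofPred_eq, and_iff_left_iff_imp]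
  intro hu g v hv
  obtain ⟨j, hj, hu⟩ := (Nat.dvd_prime_pow hp).1 (orderOf_dvd_of_pow_eq_one hu)
  rw [pow_val_eq_self_iff hp (by omega) hu]
  have h1 := (pow_prime_pow_eq_one_iff hp hp2 (i := 1) (by norm_num) v).1
    (by rw [pow_one]; exact h g v hv)
  exact (pow_dvd_pow _ hj).trans h1

/-- Some `v` is not `1` modulo `p ^ 2`, which excludes `u` of order `p ^ 2`; all `v` are `1` modulo
`p`, so `u ^ p = 1` suffices. -/
lemma ncard_stableMultipliers_of_pow_ne_one (hp : p.Prime) (hp2 : Odd p)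
    (h : ∀ g v, IsAffine c (θ g) v 0 → v ^ p ^ 2 = 1)
    (h' : ∃ g v, IsAffine c (θ g) v 0 ∧ v ^ p ≠ 1) :
    (stableMultipliers θ c).ncard = p := by
  conv_rhs => rw [← ncard_pow_eq_one hp hp2 (m := p)
    ((dvd_pow_self p two_ne_zero).trans (dvd_mul_right _ _))]
  congr 1
  ext u
  rw [mem_stableMultipliers_iff θ c hp hp2, Set.mem_ofPred_eq]
  constructor
  · rintro ⟨hu, h1⟩
    obtain ⟨g, v, hv, hv'⟩ := h'
    obtain ⟨j, hj, hu⟩ := (Nat.dvd_prime_pow hp).1 (orderOf_dvd_of_pow_eq_one hu)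
    have h2 := (pow_val_eq_self_iff hp (by omega) hu).1 (h1 g v hv)
    have h3 : j ≠ 2 := by
      rintro rfl
      exact hv' (by simpa using (pow_prime_pow_eq_one_iff hp hp2 (i := 1) (by norm_num) v).2 h2)
    rw [← orderOf_dvd_iff_pow_eq_one, hu]
    exact pow_dvd_pow (n := 1) p (by omega) |>.trans (by rw [pow_one])
  · intro hu
    refine ⟨by rw [pow_two, pow_mul, hu, one_pow], fun g v hv => ?_⟩
    obtain ⟨j, hj, hu⟩ := (Nat.dvd_prime_pow hp).1
      (show orderOf u ∣ p ^ 1 by rw [pow_one]; exact orderOf_dvd_of_pow_eq_one hu)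
    rw [pow_val_eq_self_iff hp (by omega) hu]
    exact (pow_dvd_pow _ hj).trans
      ((pow_prime_pow_eq_one_iff hp hp2 le_rfl v).1 (h g v hv))

/-- A stabilizer element with `v - 1` prime to `p` forces the order of `u` to be `1`. -/
lemma ncard_stableMultipliers_of_isUnit (hp : p.Prime) (hp2 : Odd p)
    (h : ∃ g v, IsAffine c (θ g) v 0 ∧ IsUnit (v - 1)) :
    (stableMultipliers θ c).ncard = 1 := by
  have : NeZero (p ^ 3) := ⟨pow_ne_zero _ hp.ne_zero⟩
  rw [Set.ncard_eq_one]
  refine ⟨1, ?_⟩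
  ext u
  rw [mem_stableMultipliers_iff θ c hp hp2, Set.mem_singleton_iff]
  constructor
  · rintro ⟨hu, h1⟩
    obtain ⟨g, v, hv, hv'⟩ := h
    obtain ⟨j, hj, hu⟩ := (Nat.dvd_prime_pow hp).1 (orderOf_dvd_of_pow_eq_one hu)
    have h2 := (pow_val_eq_self_iff hp (by omega) hu).1 (h1 g v hv)
    rcases Nat.eq_zero_or_pos j with rfl | h3
    · rwa [pow_zero, orderOf_eq_one_iff] at hu
    · have h4 := isUnit_of_dvd_unit ((dvd_pow_self _ h3.ne').trans h2) hv'
      have h5 := (ZMod.isUnit_iff_coprime p (p ^ 3)).1 h4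
      exact absurd (Nat.Coprime.eq_one_of_dvd h5 (dvd_pow_self _ three_ne_zero)) hp.ne_one
  · rintro rfl
    exact ⟨one_pow _, fun _ _ _ => one_pow _⟩

end PrimeCubeCount

/-! ### Transitive groups of affine permutations and their stabilizers -/

section AffineActions

variable {X G : Type*} [Group G]

/-- The stabilizer of the point `x`. -/
def pointStabilizer (θ : G →* Equiv.Perm X) (x : X) : Subgroup G :=
  (MulAction.stabilizer (Equiv.Perm X) x).comap θ

lemma mem_pointStabilizer {θ : G →* Equiv.Perm X} {x : X} {g : G} :
    g ∈ pointStabilizer θ x ↔ θ g x = x := Iff.rfl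

lemma isComplement'_pointStabilizer {θ : G →* Equiv.Perm X} {T : Subgroup G} {x : X}
    (h : Function.Bijective fun t : T => θ t x) : T.IsComplement' (pointStabilizer θ x) := by
  let _ : MulAction G X := MulAction.compHom X θ
  have hsmul (g : G) (y : X) : g • y = θ g y := rfl
  refine Subgroup.isComplement'_stabilizer x (fun t ht => h.1 ?_) fun g => ?_
  · change θ t x = θ (1 : T) x
    rw [OneMemClass.coe_one, map_one]
    exact ht
  · obtain ⟨t, ht⟩ := h.2 (g • x)
    refine ⟨t⁻¹, ?_⟩
    rw [inv_smul_eq_iff]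
    exact ht.symm

/-- A normal cyclic subgroup whose order is the cardinality of `X` is regular. -/
lemma bijective_of_normal_of_isCyclic [Finite X] {θ : G →* Equiv.Perm X}
    (hθ : Function.Injective θ) (htrans : ∀ x y, ∃ g, θ g x = y) {T : Subgroup G} [T.Normal]
    [IsCyclic T] (hT : Nat.card T = Nat.card X) (x : X) :
    Function.Bijective fun t : T => θ t x := by
  have : Nonempty X := ⟨x⟩
  have : Finite T := Nat.finite_of_card_ne_zero (by rw [hT]; exact Nat.card_pos.ne')
  have hfix (t : T) (ht : θ t x = x) : t = 1 := by
    refine Subtype.ext (hθ ?_)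
    rw [OneMemClass.coe_one, map_one]
    ext y
    obtain ⟨g, rfl⟩ := htrans x y
    -- Conjugation on the cyclic group `T` is a power map, so `t` fixes `g x` as soon as it fixes
    -- `x`.
    obtain ⟨m, hm⟩ := MonoidHom.map_cyclic (MulAut.conjNormal g⁻¹ : MulAut T).toMonoidHom
    have h1 : g⁻¹ * t * g = (t : G) ^ m := by
      have := congrArg Subtype.val (hm t)
      simpa using this
    have h2 : (t : G) * g = g * (t : G) ^ m := by rw [← h1]; group
    rw [← Equiv.Perm.mul_apply, ← map_mul, h2, map_mul, map_zpow, Equiv.Perm.mul_apply,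
      Equiv.Perm.one_apply, Equiv.Perm.zpow_apply_eq_self_of_apply_eq_self ht]
  refine (Nat.bijective_iff_injective_and_card _).2 ⟨fun s t hst => ?_, hT⟩
  have h1 := hfix (t⁻¹ * s) (by
    simp only [Subgroup.coe_mul, InvMemClass.coe_inv, map_mul, map_inv, Equiv.Perm.mul_apply]
    rw [Equiv.Perm.inv_eq_iff_eq]
    exact hst)
  exact (inv_mul_eq_one.1 h1).symm

variable {n : ℕ}

/-- A regular normal cyclic subgroup gives a regular group of permutations normalized by `G`. -/
lemma map_mem_stableRegular [NeZero n] {θ : G →* Equiv.Perm X} (hθ : Function.Injective θ)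
    {T : Subgroup G} [T.Normal] [IsCyclic T] (hT : Nat.card T = n)
    (hreg : ∀ x, Function.Bijective fun t : T => θ t x) :
    T.map θ ∈ stableRegular θ (Multiplicative (ZMod n)) := by
  let ε : T ≃* T.map θ := T.equivMapOfInjective θ hθ
  refine ⟨fun x => ?_, ?_, ⟨(mulEquivOfCyclicCardEq (by
    rw [hT, Nat.card_congr Multiplicative.toAdd, Nat.card_zmod])).trans ε⟩⟩
  · rw [← Function.Bijective.of_comp_iff _ ε.bijective]
    exact hreg x
  · rintro g _ ⟨t, ht, rfl⟩
    exact ⟨g * t * g⁻¹, ‹T.Normal›.conj_mem t ht g, by simp⟩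

lemma exists_affine_chart [NeZero n] {θ : G →* Equiv.Perm X} {R : Subgroup (Equiv.Perm X)}
    (hR : R ∈ stableRegular θ (Multiplicative (ZMod n))) (x : X) :
    ∃ c : ZMod n ≃ X, c 0 = x ∧ R = (translationHom c).range ∧
      ∀ g, ∃ v b, IsAffine c (θ g) v b := by
  obtain ⟨hreg, hnorm, ⟨ε⟩⟩ := hR
  obtain ⟨c, h0, rfl, -⟩ := exists_chart hreg ε x
  exact ⟨c, h0, rfl, fun g => exists_isAffine (hnorm g)⟩

section Multiplier

variable {θ : G →* Equiv.Perm X} {c : ZMod n ≃ X} (hc : ∀ g, ∃ v b, IsAffine c (θ g) v b)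

/-- The linear parts of the affine maps. -/
noncomputable def multiplierHom : G →* (ZMod n)ˣ where
  toFun g := (hc g).choose_spec.choose_spec.isUnit.unit
  map_one' := by
    ext
    have h : IsAffine c (θ 1) 1 0 := by
      rw [map_one]
      exact isAffine_one c
    exact ((hc 1).choose_spec.choose_spec.coeff_eq h).1
  map_mul' g h := by
    ext
    have h1 := (hc g).choose_spec.choose_spec.mul (hc h).choose_spec.choose_spec
    rw [← map_mul] at h1
    exact ((hc (g * h)).choose_spec.choose_spec.coeff_eq h1).1

lemma isAffine_multiplierHom (g : G) : ∃ b, IsAffine c (θ g) (multiplierHom hc g) b :=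
  ⟨_, (hc g).choose_spec.choose_spec⟩

lemma IsAffine.multiplierHom_eq {g : G} {v b : ZMod n} (h : IsAffine c (θ g) v b) :
    multiplierHom hc g = v :=
  ((hc g).choose_spec.choose_spec.coeff_eq h).1

lemma IsAffine.apply_zero_eq_iff {f : Equiv.Perm X} {v b : ZMod n} (h : IsAffine c f v b) :
    f (c 0) = c 0 ↔ b = 0 := by
  rw [h, c.injective.eq_iff, mul_zero, zero_add]

lemma isAffine_of_mem_pointStabilizer {g : G} (hg : g ∈ pointStabilizer θ (c 0)) :
    IsAffine c (θ g) (multiplierHom hc g) 0 := by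
  obtain ⟨b, hb⟩ := isAffine_multiplierHom hc g
  rwa [← hb.apply_zero_eq_iff.1 hg]

/-- The linear parts of the elements of the stabilizer. -/
noncomputable def stabilizerMultiplierHom : pointStabilizer θ (c 0) →* (ZMod n)ˣ :=
  (multiplierHom hc).comp (pointStabilizer θ (c 0)).subtype

lemma isAffine_stabilizerMultiplierHom (g : pointStabilizer θ (c 0)) :
    IsAffine c (θ g) (stabilizerMultiplierHom hc g) 0 :=
  isAffine_of_mem_pointStabilizer hc g.2

lemma stabilizerMultiplierHom_injective (hθ : Function.Injective θ) :
    Function.Injective (stabilizerMultiplierHom hc) := fun g h hgh => by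
  have h1 := isAffine_stabilizerMultiplierHom hc g
  rw [hgh] at h1
  exact Subtype.ext (hθ (h1.eq (isAffine_stabilizerMultiplierHom hc h)))

lemma exists_stabilizerMultiplierHom {g : G} {v : ZMod n} (h : IsAffine c (θ g) v 0) :
    ∃ g' : pointStabilizer θ (c 0), stabilizerMultiplierHom hc g' = v :=
  ⟨⟨g, h.apply_zero_eq_iff.2 rfl⟩, h.multiplierHom_eq hc⟩

end Multiplier

end AffineActions

/-! ### Finding translations in the group -/

section Translations

variable {X G : Type*} [Group G] {n : ℕ} {θ : G →* Equiv.Perm X} {c : ZMod n ≃ X}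

lemma isCycleMultiplier_one : IsCycleMultiplier (1 : ZMod n) := fun k => by
  simp [geomSum, ZMod.natCast_eq_zero_iff]

lemma IsAffine.orderOf_eq (hθ : Function.Injective θ) {g : G} {u : ZMod n}
    (hg : IsAffine c (θ g) u 1) (hu : IsCycleMultiplier u) : orderOf g = n := by
  refine Nat.dvd_antisymm (orderOf_dvd_of_pow_eq_one (hθ ?_)) ?_
  · have h := geomSum_mul_sub_one u n
    have h0 := (hu n).2 dvd_rfl
    rw [h0, zero_mul, eq_comm, sub_eq_zero] at h
    have h1 := hg.pow n
    rw [h, h0, mul_zero] at h1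
    rw [map_pow, map_one]
    exact h1.eq (isAffine_one c)
  · have h1 := hg.pow (orderOf g)
    rw [← map_pow, pow_orderOf_eq_one, map_one, one_mul] at h1
    exact (hu _).1 (h1.coeff_eq (isAffine_one c)).2

/-- If `G` contains a generator of the translations, then these form a normal subgroup of `G`. -/
lemma exists_normal_isCyclic_of_translation [NeZero n] (hθ : Function.Injective θ)
    (hc : ∀ g, ∃ v b, IsAffine c (θ g) v b) {g : G} (hg : θ g = translation c 1) :
    ∃ T : Subgroup G, T.Normal ∧ IsCyclic T ∧ Nat.card T = n := by
  refine ⟨Subgroup.zpowers g, ⟨?_⟩, inferInstance, ?_⟩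
  · rintro _ ⟨k, rfl⟩ h
    obtain ⟨v, b, hv⟩ := hc h
    have h1 : h * g * h⁻¹ = g ^ v.val := by
      refine hθ ?_
      rw [map_mul, map_mul, map_inv, hg, hv.conj_translation, map_pow, hg, ← translation_natCast,
        ZMod.natCast_zmod_val, mul_one]
    simp only
    rw [← conj_zpow, h1]
    exact Subgroup.zpow_mem _ (Subgroup.pow_mem _ (Subgroup.mem_zpowers g) _) _
  · rw [Nat.card_zpowers]
    exact IsAffine.orderOf_eq hθ (by rw [hg]; exact isAffine_translation c 1) isCycleMultiplier_one

/-- An affine map `i ↦ v i + b` with `v - 1` a unit has a conjugate fixing `0`, and commuting it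
with a suitable element gives a translation. -/
lemma exists_translation_of_isUnit [NeZero n] (hc : ∀ g, ∃ v b, IsAffine c (θ g) v b)
    (htrans : ∀ x y, ∃ g, θ g x = y) {w : G} (hw : IsUnit ((multiplierHom hc w : ZMod n) - 1)) :
    ∃ g, θ g = translation c 1 := by
  obtain ⟨b, hb⟩ := isAffine_multiplierHom hc w
  set v : ZMod n := ((multiplierHom hc w : (ZMod n)ˣ) : ZMod n) with hv
  obtain ⟨y, hy⟩ := hw.exists_right_inv
  -- With `y = (v - 1)⁻¹`, the point `-b * y` is the fixed point of `i ↦ v i + b`.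
  obtain ⟨h, hh⟩ := htrans (c 0) (c (-b * y))
  have h1 : h⁻¹ * w * h ∈ pointStabilizer θ (c 0) := by
    rw [mem_pointStabilizer, map_mul, map_mul, map_inv, Equiv.Perm.mul_apply, hh,
      Equiv.Perm.mul_apply, Equiv.Perm.inv_eq_iff_eq, hh, hb]
    congr 1
    linear_combination (-b) * hy
  have h2 := isAffine_of_mem_pointStabilizer hc h1
  have h5 : multiplierHom hc (h⁻¹ * w * h) = multiplierHom hc w := by
    rw [map_mul, map_mul, map_inv, inv_mul_cancel_comm]
  rw [h5, ← hv] at h2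
  obtain ⟨g, hg⟩ := htrans (c 0) (c 1)
  obtain ⟨j, hj⟩ := isAffine_multiplierHom hc g
  obtain rfl : j = 1 := by
    rw [hj, c.injective.eq_iff, mul_zero, zero_add] at hg
    exact hg
  -- The two products have the same linear part and constant terms `v` and `1`, so they differ by
  -- the translation by `v - 1`.
  have h3 : θ (h⁻¹ * w * h * g * (g * (h⁻¹ * w * h))⁻¹) = translation c (v - 1) := by
    rw [map_mul, map_inv, mul_inv_eq_iff_eq_mul, map_mul _ g, map_mul _ _ g]
    refine (h2.mul hj).eq ?_
    have h4 := (isAffine_translation c (v - 1)).mul (hj.mul h2)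
    convert h4 using 1 <;> ring
  refine ⟨(h⁻¹ * w * h * g * (g * (h⁻¹ * w * h))⁻¹) ^ y.val, ?_⟩
  rw [map_pow, h3, translation_pow, ZMod.natCast_zmod_val, mul_comm, hy]

lemma card_eq_card_mul_card_pointStabilizer [Finite G] (htrans : ∀ x y, ∃ g, θ g x = y) (x : X) :
    Nat.card G = Nat.card X * Nat.card (pointStabilizer θ x) := by
  let _ : MulAction G X := MulAction.compHom X θ
  have : MulAction.IsPretransitive G X := ⟨htrans⟩
  rw [← MulAction.index_stabilizer_of_transitive G x]
  exact (Subgroup.index_mul_card _).symm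

lemma exists_normal_isCyclic_of_mulEquiv {N H : Type*} [Group N] [IsCyclic N] [Group H]
    {φ : H →* MulAut N} (ψ : G ≃* N ⋊[φ] H) :
    ∃ T : Subgroup G, T.Normal ∧ IsCyclic T ∧ Nat.card T = Nat.card N := by
  have hinj : Function.Injective (ψ.symm.toMonoidHom.comp (SemidirectProduct.inl (φ := φ))) :=
    ψ.symm.injective.comp SemidirectProduct.inl_injective
  have hrange : (ψ.symm.toMonoidHom.comp (SemidirectProduct.inl (φ := φ))).range =
      (SemidirectProduct.rightHom.comp ψ.toMonoidHom).ker := by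
    rw [MonoidHom.range_comp, SemidirectProduct.range_inl_eq_ker_rightHom, ← MonoidHom.comap_ker]
    exact (Subgroup.map_symm_eq_iff_map_eq _).2 (Subgroup.map_comap_eq_self_of_surjective ψ.surjective _)
  let ε := MonoidHom.ofInjective hinj
  exact ⟨_, by rw [hrange]; infer_instance, isCyclic_of_surjective ε ε.surjective,
    (Nat.card_congr ε.toEquiv).symm⟩

end Translations

/-! ### Group structure and counting in degree `p ^ 3` -/

section PrimeCubeGroups

variable {X G : Type*} [Group G] {p : ℕ} {θ : G →* Equiv.Perm X} {c : ZMod (p ^ 3) ≃ X}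

lemma isCyclic_pointStabilizer (hp : p.Prime) (hp2 : Odd p) (hθ : Function.Injective θ)
    (hc : ∀ g, ∃ v b, IsAffine c (θ g) v b) : IsCyclic (pointStabilizer θ (c 0)) := by
  have := ZMod.isCyclic_units_of_prime_pow p hp (by rintro rfl; exact absurd hp2 (by decide)) 3
  exact isCyclic_of_injective _ (stabilizerMultiplierHom_injective hc hθ)

lemma card_pointStabilizer_dvd (hp : p.Prime) (hθ : Function.Injective θ)
    (hc : ∀ g, ∃ v b, IsAffine c (θ g) v b) :
    Nat.card (pointStabilizer θ (c 0)) ∣ p ^ 2 * (p - 1) := by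
  rw [← card_units_prime_cube hp]
  exact Subgroup.card_dvd_of_injective _ (stabilizerMultiplierHom_injective hc hθ)

/-- If `G` normalizes a regular cyclic group of order `p ^ 3`, then it has a regular normal cyclic
subgroup. -/
theorem exists_normal_isCyclic_of_stableRegular [Finite G] (hp : p.Prime) (hp2 : Odd p)
    (hθ : Function.Injective θ) (htrans : ∀ x y, ∃ g, θ g x = y)
    (hc : ∀ g, ∃ v b, IsAffine c (θ g) v b) :
    ∃ T : Subgroup G, T.Normal ∧ IsCyclic T ∧ Nat.card T = p ^ 3 := by
  have : NeZero (p ^ 3) := ⟨pow_ne_zero _ hp.ne_zero⟩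
  have := Fact.mk hp
  by_cases hunit : ∃ w, IsUnit ((multiplierHom hc w : ZMod (p ^ 3)) - 1)
  · obtain ⟨w, hw⟩ := hunit
    obtain ⟨g, hg⟩ := exists_translation_of_isUnit hc htrans hw
    exact exists_normal_isCyclic_of_translation hθ hc hg
  -- In the remaining case every linear part is `1` modulo `p`, so the stabilizer is a `p`-group.
  have hpow (w : G) : (multiplierHom hc w : ZMod (p ^ 3)) ^ p ^ 2 = 1 := by
    rw [pow_prime_pow_eq_one_iff hp hp2 le_rfl, show 3 - 2 = 1 from rfl, pow_one]
    by_contra h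
    exact hunit ⟨w, isUnit_of_not_prime_dvd hp h⟩
  obtain ⟨g, hg⟩ := htrans (c 0) (c 1)
  obtain ⟨b, hgb⟩ := isAffine_multiplierHom hc g
  obtain rfl : b = 1 := by
    rw [hgb, c.injective.eq_iff, mul_zero, zero_add] at hg
    exact hg
  have hcyc := isCyclic_pointStabilizer hp hp2 hθ hc
  have hcard : Nat.card (pointStabilizer θ (c 0)) ∣ p ^ 2 := by
    rw [← IsCyclic.exponent_eq_card]
    refine Monoid.exponent_dvd_of_forall_pow_eq_one fun h => ?_
    refine stabilizerMultiplierHom_injective hc hθ ?_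
    rw [map_pow, map_one]
    ext
    rw [Units.val_pow_eq_pow_val]
    exact hpow h
  obtain ⟨j, hj, hcard⟩ := (Nat.dvd_prime_pow hp).1 hcard
  by_cases hj2 : j = 2
  -- A stabilizer of order `p ^ 2` realizes every linear part that occurs; dividing `g` by the
  -- matching element leaves the translation by `1`.
  · have h1 : Set.range (Units.val ∘ stabilizerMultiplierHom hc) =
        {u | u ^ p ^ 2 = 1} := by
      refine Set.eq_of_subset_of_ncard_le ?_ ?_ (Set.toFinite _)
      · rintro _ ⟨h, rfl⟩
        exact hpow h
      · rw [ncard_pow_eq_one hp hp2 (dvd_mul_right _ _), ← Set.image_univ,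
          Set.ncard_image_of_injective _
            (Units.val_injective.comp (stabilizerMultiplierHom_injective hc hθ)),
          Set.ncard_univ, hcard, hj2]
    obtain ⟨h, hh⟩ := h1.ge (hpow g)
    have h2 := isAffine_stabilizerMultiplierHom hc h
    rw [Function.comp_apply] at hh
    rw [hh] at h2
    refine exists_normal_isCyclic_of_translation (g := g * (h : G)⁻¹) hθ hc ?_
    rw [map_mul, map_inv, mul_inv_eq_iff_eq_mul]
    refine hgb.eq ?_
    have h3 := (isAffine_translation c 1).mul h2
    convert h3 using 1 <;> ring
  -- Otherwise `g` itself, a `p ^ 3`-cycle, generates a subgroup of index `1` or `p` in a `p`-group,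
  -- hence a normal one.
  · have hunit : IsUnit (multiplierHom hc g : ZMod (p ^ 3)) := Units.isUnit _
    have hord := hgb.orderOf_eq hθ ((isCycleMultiplier_iff hp hp2 hunit).2 (hpow g))
    rw [← Nat.card_zpowers] at hord
    refine ⟨Subgroup.zpowers g, ?_, inferInstance, hord⟩
    have h1 := card_eq_card_mul_card_pointStabilizer htrans (c 0)
    have h2 := Subgroup.card_mul_index (Subgroup.zpowers g)
    rw [← Nat.card_congr c, Nat.card_zmod, hcard] at h1
    rw [hord, h1] at h2
    have h3 := Nat.eq_of_mul_eq_mul_left (pow_pos hp.pos 3) h2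
    obtain rfl | rfl : j = 0 ∨ j = 1 := by omega
    · rw [Subgroup.index_eq_one.1 h3]
      infer_instance
    · refine Subgroup.normal_of_index_eq_minFac_card ?_
      rw [h3, h1, ← pow_add, hp.pow_minFac (by norm_num), pow_one]

/-- A group with a regular normal cyclic subgroup of order `p ^ 3` is a semidirect product. -/
theorem exists_mulEquiv_semidirectProduct [NeZero (p ^ 3)] [Finite X] (hp : p.Prime) (hp2 : Odd p)
    (hθ : Function.Injective θ) (hX : Nat.card X = p ^ 3) (htrans : ∀ x y, ∃ g, θ g x = y) (x : X)
    {T : Subgroup G} [T.Normal] [IsCyclic T] (hT : Nat.card T = p ^ 3) :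
    ∃ a d : ℕ, a ≤ 2 ∧ d ∣ p - 1 ∧
      ∃ φ : CyclicGrp (p ^ a * d) →* MulAut (CyclicGrp (p ^ 3)), Function.Injective φ ∧
        Nonempty (G ≃* CyclicGrp (p ^ 3) ⋊[φ] CyclicGrp (p ^ a * d)) := by
  have hreg := bijective_of_normal_of_isCyclic hθ htrans (hT.trans hX.symm)
  obtain ⟨c, rfl, -, hc⟩ := exists_affine_chart (map_mem_stableRegular hθ hT hreg) x
  have hcyc := isCyclic_pointStabilizer hp hp2 hθ hc
  obtain ⟨_, d, h1, hd, hcard⟩ := (Nat.dvd_mul).1 (card_pointStabilizer_dvd hp hθ hc)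
  obtain ⟨a, ha, rfl⟩ := (Nat.dvd_prime_pow hp).1 h1
  let f₁ : T ≃* CyclicGrp (p ^ 3) := mulEquivOfCyclicCardEq (by
    rw [hT, Nat.card_congr Multiplicative.toAdd, Nat.card_zmod])
  let f₂ : pointStabilizer θ (c 0) ≃* CyclicGrp (p ^ a * d) := mulEquivOfCyclicCardEq (by
    rw [← hcard, Nat.card_congr Multiplicative.toAdd, Nat.card_zmod])
  have hcompl := isComplement'_pointStabilizer (hreg (c 0))
  refine ⟨a, d, ha, hd, _, ?_,
    ⟨(SemidirectProduct.mulEquivSubgroup hcompl).symm.trans (SemidirectProduct.congr' f₁ f₂)⟩⟩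
  suffices h : Function.Injective (T.normalizerMonoidHom.comp (Subgroup.inclusion
      (T.normalizer_eq_top ▸ le_top : pointStabilizer θ (c 0) ≤ Subgroup.normalizer T))) from
    (MulAut.congr f₁).injective.comp (h.comp f₂.symm.injective)
  -- A stabilizer element that centralizes the transitive group `T` fixes every point.
  refine (injective_iff_map_eq_one _).2 fun k hk => Subtype.ext (hθ ?_)
  rw [OneMemClass.coe_one, map_one]
  ext y
  obtain ⟨t, rfl⟩ := (hreg (c 0)).2 y
  have h2 : (k : G) * t * (k : G)⁻¹ = t := congrArg Subtype.val (DFunLike.congr_fun hk t)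
  have h3 : (k : G) * t = t * k := mul_inv_eq_iff_eq_mul.1 h2
  simp only
  rw [← Equiv.Perm.mul_apply, ← map_mul, h3, map_mul, Equiv.Perm.mul_apply,
    mem_pointStabilizer.1 k.2,
    Equiv.Perm.one_apply]

/-- The number of multipliers in terms of the order of the stabilizer. -/
theorem ncard_stableMultipliers (hp : p.Prime) (hp2 : Odd p) (hθ : Function.Injective θ)
    (hc : ∀ g, ∃ v b, IsAffine c (θ g) v b) {a d : ℕ} (hd : d ∣ p - 1)
    (hcard : Nat.card (pointStabilizer θ (c 0)) = p ^ a * d) :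
    (1 < d → (stableMultipliers θ c).ncard = 1) ∧
      (p ^ a * d = 1 → (stableMultipliers θ c).ncard = p ^ 2) ∧
      (d = 1 → a = 1 ∨ a = 2 → (stableMultipliers θ c).ncard = p ^ (3 - a)) := by
  have hpos : 0 < p ^ a * d := Nat.mul_pos (pow_pos hp.pos _)
    (Nat.pos_of_dvd_of_pos hd (Nat.sub_pos_of_lt hp.one_lt))
  have : Finite (pointStabilizer θ (c 0)) :=
    Nat.finite_of_card_ne_zero (by rw [hcard]; exact hpos.ne')
  have hinj := stabilizerMultiplierHom_injective hc hθ
  have hpow {k : ℕ} (hk : p ^ a * d ∣ k) (g : G) (v : ZMod (p ^ 3)) (hv : IsAffine c (θ g) v 0) :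
      v ^ k = 1 := by
    obtain ⟨h, rfl⟩ := exists_stabilizerMultiplierHom hc hv
    rw [← Units.val_pow_eq_pow_val, ← map_pow,
      orderOf_dvd_iff_pow_eq_one.1 ((orderOf_dvd_natCard h).trans (hcard ▸ hk)), map_one,
      Units.val_one]
  refine ⟨fun h1 => ?_, fun h1 => ?_, ?_⟩
  -- Take an element of prime order `q` dividing `d`. Were its multiplier `1` modulo `p`, its order
  -- would divide `p ^ 2`, giving `q = p`, impossible as `q` divides `p - 1`.
  · obtain ⟨q, hq, hqd⟩ := Nat.exists_prime_and_dvd h1.ne'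
    have := Fact.mk hq
    obtain ⟨h, hh⟩ := exists_prime_orderOf_dvd_card' (G := pointStabilizer θ (c 0)) q
      (hcard ▸ hqd.trans (dvd_mul_left _ _))
    refine ncard_stableMultipliers_of_isUnit θ c hp hp2
      ⟨h, _, isAffine_stabilizerMultiplierHom hc h, isUnit_of_not_prime_dvd hp fun hdvd => ?_⟩
    have h2 := (pow_prime_pow_eq_one_iff hp hp2 le_rfl _).2
      (show (p : ZMod (p ^ 3)) ^ (3 - 2) ∣ _ by rwa [show 3 - 2 = 1 from rfl, pow_one])
    have h3 := orderOf_dvd_of_pow_eq_one h2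
    rw [orderOf_units, orderOf_injective _ hinj, hh] at h3
    rw [(Nat.prime_dvd_prime_iff_eq hq hp).1 (hq.dvd_of_dvd_pow h3)] at hqd
    exact Nat.not_dvd_of_pos_of_lt (Nat.sub_pos_of_lt hp.one_lt) (Nat.sub_lt hp.pos one_pos)
      (hqd.trans hd)
  · exact ncard_stableMultipliers_of_pow_eq_one θ c hp hp2 (hpow (h1 ▸ one_dvd p))
  · rintro rfl (rfl | rfl)
    · exact ncard_stableMultipliers_of_pow_eq_one θ c hp hp2 (hpow (by simp))
    -- A generator of the stabilizer has order `p ^ 2`, so its `p`-th power is not trivial.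
    · have hcyc := isCyclic_pointStabilizer hp hp2 hθ hc
      obtain ⟨h, hh⟩ := IsCyclic.exists_ofOrder_eq_natCard (α := pointStabilizer θ (c 0))
      rw [show 3 - 2 = 1 from rfl, pow_one]
      refine ncard_stableMultipliers_of_pow_ne_one θ c hp hp2 (hpow (by simp))
        ⟨h, _, isAffine_stabilizerMultiplierHom hc h, fun h2 => ?_⟩
      have h3 := orderOf_dvd_of_pow_eq_one h2
      rw [orderOf_units, orderOf_injective _ hinj, hh, hcard, mul_one] at h3
      have h4 := Nat.le_of_dvd hp.pos h3
      nlinarith [hp.two_le]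

end PrimeCubeGroups

/-! ### The main theorem -/

theorem propositionp3 {K : Type u} {L : Type v} {E : Type w} [Field K] [Field L] [Field E]
    [Algebra K L] [Algebra.IsSeparable K L]
    [Algebra K E] [Algebra L E] [IsScalarTower K L E] [IsNormalClosure K L E]
    (p : ℕ) (hp : p.Prime) (hp2 : Odd p) (hdeg : Module.finrank K L = p ^ 3) :
    ((∃ S : HopfGaloisStructure K L, S.HasType E (CyclicGrp (p ^ 3))) ↔
      ∃ a d : ℕ, a ≤ 2 ∧ d ∣ p - 1 ∧
        ∃ φ : CyclicGrp (p ^ a * d) →* MulAut (CyclicGrp (p ^ 3)), Function.Injective φ ∧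
          Nonempty ((E ≃ₐ[K] E) ≃* CyclicGrp (p ^ 3) ⋊[φ] CyclicGrp (p ^ a * d))) ∧
    ∀ a d : ℕ, a ≤ 2 → d ∣ p - 1 →
      ∀ φ : CyclicGrp (p ^ a * d) →* MulAut (CyclicGrp (p ^ 3)),
        Nonempty ((E ≃ₐ[K] E) ≃* CyclicGrp (p ^ 3) ⋊[φ] CyclicGrp (p ^ a * d)) →
          (1 < d → HopfGaloisStructure.numberOfType K L E (CyclicGrp (p ^ 3)) = 1) ∧
          (p ^ a * d = 1 →
            HopfGaloisStructure.numberOfType K L E (CyclicGrp (p ^ 3)) = p ^ 2) ∧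
          (d = 1 → a = 1 ∨ a = 2 →
            HopfGaloisStructure.numberOfType K L E (CyclicGrp (p ^ 3)) = p ^ (3 - a)) := by
  have : NeZero (p ^ 3) := ⟨pow_ne_zero _ hp.ne_zero⟩
  have : FiniteDimensional K L :=
    Module.finite_of_finrank_pos (by rw [hdeg]; exact pow_pos hp.pos 3)
  have : FiniteDimensional K E := finiteDimensional_of_isNormalClosure K L E
  let x : L →ₐ[K] E := IsScalarTower.toAlgHom K L E
  have : Nonempty (L →ₐ[K] E) := ⟨x⟩
  have hX : Nat.card (L →ₐ[K] E) = p ^ 3 := by rw [card_embeddings, hdeg]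
  have hθ := embeddingPerm_injective K L E
  have htrans := embeddingPerm_transitive K L E
  rw [HopfGaloisStructure.exists_hasType_iff, HopfGaloisStructure.numberOfType_eq_ncard]
  set θ := embeddingPerm K L E
  have hnormal (a d : ℕ) (φ : CyclicGrp (p ^ a * d) →* MulAut (CyclicGrp (p ^ 3)))
      (ψ : (E ≃ₐ[K] E) ≃* CyclicGrp (p ^ 3) ⋊[φ] CyclicGrp (p ^ a * d)) :
      ∃ T : Subgroup (E ≃ₐ[K] E), T.Normal ∧ IsCyclic T ∧ Nat.card T = p ^ 3 := by
    have h := exists_normal_isCyclic_of_mulEquiv ψ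
    rwa [Nat.card_congr Multiplicative.toAdd, Nat.card_zmod] at h
  refine ⟨⟨?_, ?_⟩, ?_⟩
  · rintro ⟨R, hR⟩
    obtain ⟨c, -, -, hc⟩ := exists_affine_chart hR x
    obtain ⟨T, hT1, hT2, hT⟩ := exists_normal_isCyclic_of_stableRegular hp hp2 hθ htrans hc
    exact exists_mulEquiv_semidirectProduct hp hp2 hθ hX htrans x hT
  · rintro ⟨a, d, -, -, φ, -, ⟨ψ⟩⟩
    obtain ⟨T, hT1, hT2, hT⟩ := hnormal a d φ ψ
    exact ⟨_, map_mem_stableRegular hθ hT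
      (bijective_of_normal_of_isCyclic hθ htrans (hT.trans hX.symm))⟩
  · rintro a d - hd φ ⟨ψ⟩
    obtain ⟨T, hT1, hT2, hT⟩ := hnormal a d φ ψ
    obtain ⟨c, -, hrange, hc⟩ := exists_affine_chart (map_mem_stableRegular hθ hT
      (bijective_of_normal_of_isCyclic hθ htrans (hT.trans hX.symm))) x
    obtain ⟨t, -, ht⟩ : translation c 1 ∈ T.map θ := hrange ▸ ⟨_, rfl⟩
    rw [ncard_stableRegular θ hc ⟨t, ht⟩]
    refine ncard_stableMultipliers hp hp2 hθ hc hd ?_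
    -- Only the order of `G` enters here, so the stabilizer has order `p ^ a * d` without assuming
    -- `φ` injective.
    have h1 := card_eq_card_mul_card_pointStabilizer htrans (c 0)
    rw [hX, Nat.card_congr ψ.toEquiv, SemidirectProduct.card,
      Nat.card_congr Multiplicative.toAdd, Nat.card_congr Multiplicative.toAdd, Nat.card_zmod,
      Nat.card_zmod] at h1
    exact (Nat.eq_of_mul_eq_mul_left (pow_pos hp.pos 3) h1).symm
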